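/- Let $m\ge 2$, let $p,q$ be odd primes with $q-p=2^m$, and let $D=D_1\cdots D_n$ ($n\ge 0$) be a product of distinct odd primes $D_i$, with $p\nmid D$ and $q\nmid D$. Put $\widehat{D_i}=D/D_i$ and $Z(n)=\{1,\dots,n\}$. Consider the elliptic curves $$E:\ y^2=x(x+pD)(x+qD),\qquad E':\ y^2=x^3-2(p+q)Dx^2+4^mD^2x$$ over $\mathbb{Q}$ and the isogeny $$\widehat{\varphi}:E'\to E,\quad (x,y)\mapsto\Big(\frac{y^2}{4x^2},\ \frac{y(4^mD^2-x^2)}{8x^2}\Big)$$ of degree $2$, with kernel $\{O,(0,0)\}$. Let $$S^{(\widehat{\varphi})}(E'/\mathbb{Q})=\ker\Big(H^1(\mathbb{Q},E'[\widehat{\varphi}])\to\prod_v H^1(\mathbb{Q}_v,E')\Big)$$ be its Selmer group, where $v$ runs over all places of $\mathbb{Q}$; it is regarded as a subgroup of $\mathbb{Q}^{\star}/\mathbb{Q}^{\star 2}\cong H^1(\mathbb{Q},E'[\widehat{\varphi}])$. With $\left(\frac{\cdot}{\cdot}\right)$ the Legendre symbol, put for $i\in Z(n)$ $$\Pi_i^+(D')=\Big(1-\Big(\tfrac{-q\widehat{D_i}}{D_i}\Big)\Big)\Big(1-\Big(\tfrac{-p\widehat{D_i}}{D_i}\Big)\Big)+\sum_{j\ne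 i}\Big(1-\Big(\tfrac{D_i}{D_j}\Big)\Big)\Big(1-\Big(\tfrac{pqD_i}{D_j}\Big)\Big)$$ and $$\Pi_{n+1}^+(D')=\delta'_{n+1}+\sum_{i=1}^n\Big(1-\Big(\tfrac{-1}{D_i}\Big)\Big)\Big(1-\Big(\tfrac{-pq}{D_i}\Big)\Big),$$ where $\delta'_{n+1}=0$ if ($m=2$ and $p-D\not\equiv 2 \bmod 8$) or ($m=3$ and $p-D\equiv 0\bmod 4$) or ($m\ge 4$ and $p-D\equiv 0\bmod 8$), and $\delta'_{n+1}=1$ otherwise. Let $I\subset Z(n)$ be the set of those $i$ that satisfy at least one of the following conditions. * If $m=2$: $D_i\equiv 1\ (4)$; or $D_i+pD\equiv 0\ (4)$; or $D_i\equiv 3\ (4)$ and $p-D\equiv 6\ (8)$. * If $m=3$: $D_i\equiv 1\ (8)$; or $D_i+pD\equiv 0\ (8)$; or $D_i\equiv 3\ (4)$ and $pD+D_i\equiv 4\ (8)$; or $D_i\equiv 5\ (8)$ and $pD-D_i\equiv 0\ (4)$. * If $m=4$: $D_i\equiv 1\ (8)$; or $D_i+pD\equiv 0\ (8)$; or $D_i\equiv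 5\ (8)$ and $pD+D_i\equiv 4\ (8)$. * If $m\ge 5$: $D_i\equiv 1\ (8)$; or $D_i+pD\equiv 0\ (8)$. Put $$\rho^+(D')=\sum_{i\in I\cup\{n+1\}}\Big\lfloor\frac{1}{1+\Pi_i^+(D')}\Big\rfloor .$$ Then there is a subset $T\subset\{-1,D_1,\dots,D_n\}$ with $\sharp T=\rho^+(D')$ such that the subgroup of $\mathbb{Q}^{\star}/\mathbb{Q}^{\star 2}$ generated by $T$ is contained in $S^{(\widehat{\varphi})}(E'/\mathbb{Q})$ and is isomorphic to $(\mathbb{Z}/2\mathbb{Z})^{\rho^+(D')}$. In particular, $\dim_2 S^{(\widehat{\varphi})}(E'/\mathbb{Q})\ge\rho^+(D')$. -/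

import Mathlib

/-- The data of the family of curves: `m ≥ 1`, odd primes `p` and `q` with `q - p = 2 ^ m`, and
distinct primes `D 0, …, D (n - 1)`, none of which is `2`, `p` or `q`. -/
structure FamilyData (n : ℕ) where
  m : ℕ
  p : ℕ
  q : ℕ
  D : Fin n → ℕ
  one_le_m : 1 ≤ m
  prime_p : p.Prime
  prime_q : q.Prime
  odd_p : Odd p
  odd_q : Odd q
  q_eq : q = p + 2 ^ m
  prime_D : ∀ i, (D i).Prime
  D_injective : Function.Injective D
  D_ne_two : ∀ i, D i ≠ 2
  D_ne_p : ∀ i, D i ≠ p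
  D_ne_q : ∀ i, D i ≠ q

namespace FamilyData

variable {n : ℕ} (c : FamilyData n)

instance factPrime (i : Fin n) : Fact (c.D i).Prime := ⟨c.prime_D i⟩

/-- The square-free integer `D = D₁ ⋯ Dₙ`. -/
def prodD : ℕ := ∏ i, c.D i

/-- The integer `D̂ᵢ = D / Dᵢ`. -/
def hatD (i : Fin n) : ℕ := ∏ j ∈ Finset.univ.erase i, c.D j

/-- The curve `E : y² = x (x + p D) (x + q D) = x³ + (p + q) D x² + p q D² x`. -/
def curveE : WeierstrassCurve ℚ where
  a₁ := 0
  a₂ := ((c.p : ℚ) + c.q) * c.prodD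
  a₃ := 0
  a₄ := (c.p : ℚ) * c.q * (c.prodD : ℚ) ^ 2
  a₆ := 0

/-- The curve `E' : y² = x³ - 2 (p + q) D x² + 4 ^ m D² x`. -/
def curveE' : WeierstrassCurve ℚ where
  a₁ := 0
  a₂ := -2 * ((c.p : ℚ) + c.q) * c.prodD
  a₃ := 0
  a₄ := 4 ^ c.m * (c.prodD : ℚ) ^ 2
  a₆ := 0

theorem prodD_ne_zero : (c.prodD : ℚ) ≠ 0 := by
  have : c.prodD ≠ 0 := Finset.prod_ne_zero_iff.mpr fun i _ => (c.prime_D i).ne_zero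
  exact_mod_cast this

theorem p_ne_zero : (c.p : ℚ) ≠ 0 := by exact_mod_cast c.prime_p.ne_zero

theorem q_ne_zero : (c.q : ℚ) ≠ 0 := by exact_mod_cast c.prime_q.ne_zero

theorem q_cast : (c.q : ℚ) = c.p + 2 ^ c.m := by exact_mod_cast c.q_eq

theorem four_pow : (4 : ℚ) ^ c.m = ((c.q : ℚ) - c.p) ^ 2 := by
  rw [c.q_cast, add_sub_cancel_left, ← pow_mul, mul_comm, pow_mul]; norm_num

instance curveE_isElliptic : c.curveE.IsElliptic := by
  refine ⟨isUnit_iff_ne_zero.mpr ?_⟩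
  have h : c.curveE.Δ = 16 * ((c.p : ℚ) * c.q * (c.prodD : ℚ) ^ 2) ^ 2 *
      ((4 : ℚ) ^ c.m * (c.prodD : ℚ) ^ 2) := by
    rw [c.four_pow]
    simp only [WeierstrassCurve.Δ, WeierstrassCurve.b₂, WeierstrassCurve.b₄, WeierstrassCurve.b₆,
      WeierstrassCurve.b₈, curveE]
    ring
  rw [h]
  have := c.prodD_ne_zero
  have := c.p_ne_zero
  have := c.q_ne_zero
  positivity

section Isogeny

variable (F : Type*) [Field F] [CharZero F]

/-- The points of `E` over a field `F` of characteristic zero. -/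
abbrev PointE : Type _ := (c.curveE.baseChange F).toAffine.Point

/-- The points of `E'` over a field `F` of characteristic zero. -/
abbrev PointE' : Type _ := (c.curveE'.baseChange F).toAffine.Point

variable {F}

theorem equation_curveE' {x y : F} (h : (c.curveE'.baseChange F).toAffine.Equation x y) :
    y ^ 2 = x ^ 3 - 2 * ((c.p : F) + c.q) * c.prodD * x ^ 2 +
      4 ^ c.m * (c.prodD : F) ^ 2 * x := by
  rw [WeierstrassCurve.Affine.equation_iff] at h
  simp [curveE', WeierstrassCurve.baseChange, WeierstrassCurve.map] at h
  rw [h]; ring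

theorem dualIsogeny_nonsingular {x y : F}
    (h : (c.curveE'.baseChange F).toAffine.Nonsingular x y) (hx : x ≠ 0) :
    (c.curveE.baseChange F).toAffine.Nonsingular (y ^ 2 / (4 * x ^ 2))
      (y * (4 ^ c.m * (c.prodD : F) ^ 2 - x ^ 2) / (8 * x ^ 2)) := by
  have he := c.equation_curveE' h.1
  have hF : (4 : F) ^ c.m = ((c.q : F) - c.p) ^ 2 := by
    simpa using congrArg (algebraMap ℚ F) c.four_pow
  have : (c.curveE.baseChange F).toAffine.IsElliptic :=
    inferInstanceAs ((c.curveE.map (algebraMap ℚ F)).IsElliptic)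
  rw [← WeierstrassCurve.Affine.equation_iff_nonsingular, WeierstrassCurve.Affine.equation_iff]
  simp only [curveE, WeierstrassCurve.baseChange, WeierstrassCurve.map, map_zero, map_add,
    map_mul, map_pow, map_natCast, zero_mul, add_zero]
  have e : ∀ u : F, (y * u / (8 * x ^ 2)) ^ 2 = y ^ 2 * u ^ 2 / (64 * x ^ 4) := by
    intro u; field_simp; norm_num
  rw [e, he, hF]
  field_simp
  ring

/-- The dual isogeny `φ̂ : E' → E`, `(x, y) ↦ (y² / 4x², y (4 ^ m D² - x²) / 8x²)`, which sends the
point at infinity and `(0, 0)` to the point at infinity. -/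
noncomputable def dualIsogeny [DecidableEq F] : c.PointE' F → c.PointE F
  | .zero => 0
  | .some x y h =>
    if hx : x = 0 then 0
    else .some (y ^ 2 / (4 * x ^ 2)) (y * (4 ^ c.m * (c.prodD : F) ^ 2 - x ^ 2) / (8 * x ^ 2))
      (c.dualIsogeny_nonsingular h hx)

theorem nonsingular_zero : (c.curveE'.baseChange F).toAffine.Nonsingular 0 0 := by
  have h1 : (c.prodD : F) ≠ 0 := by
    have := c.prodD_ne_zero
    exact_mod_cast this
  rw [WeierstrassCurve.Affine.nonsingular_zero]
  simp [curveE', WeierstrassCurve.baseChange, WeierstrassCurve.map, h1]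

variable (F) in
/-- The point `(0, 0)` of `E'`. -/
noncomputable def torsionPoint : c.PointE' F := .some 0 0 c.nonsingular_zero

theorem dualIsogeny_eq_zero_iff [DecidableEq F] (P : c.PointE' F) :
    c.dualIsogeny P = 0 ↔ P = 0 ∨ P = c.torsionPoint F := by
  rcases P with _ | ⟨x, y, h⟩
  · exact iff_of_true rfl (Or.inl rfl)
  · by_cases hx : x = 0
    · subst hx
      have hy : y = 0 := by simpa using c.equation_curveE' h.1
      subst hy
      simp [dualIsogeny, torsionPoint]
    · simp [dualIsogeny, torsionPoint, hx, WeierstrassCurve.Affine.Point.zero_def]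

theorem neg_torsionPoint : -c.torsionPoint F = c.torsionPoint F := by
  rw [torsionPoint, WeierstrassCurve.Affine.Point.neg_some,
    WeierstrassCurve.Affine.Point.some.injEq]
  simp [WeierstrassCurve.Affine.negY, curveE', WeierstrassCurve.baseChange, WeierstrassCurve.map]

variable [DecidableEq F]

theorem torsionPoint_add_self : c.torsionPoint F + c.torsionPoint F = 0 := by
  nth_rewrite 1 [← c.neg_torsionPoint]
  exact neg_add_cancel _

variable (F) in
/-- The kernel `E'[φ̂]` of the dual isogeny on the points of `E'` over `F`. -/
noncomputable def kerDualIsogeny : AddSubgroup (c.PointE' F) where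
  carrier := {P | c.dualIsogeny P = 0}
  zero_mem' := rfl
  add_mem' := by
    intro P Q hP hQ
    simp only [Set.mem_ofPred_eq, dualIsogeny_eq_zero_iff] at *
    rcases hP with rfl | rfl <;> rcases hQ with rfl | rfl <;> simp [torsionPoint_add_self]
  neg_mem' := by
    intro P hP
    simp only [Set.mem_ofPred_eq, dualIsogeny_eq_zero_iff] at *
    rcases hP with rfl | rfl <;> simp [neg_torsionPoint]

theorem mem_kerDualIsogeny (P : c.PointE' F) :
    P ∈ c.kerDualIsogeny F ↔ P = 0 ∨ P = c.torsionPoint F := c.dualIsogeny_eq_zero_iff P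

theorem two_nsmul_of_mem {P : c.PointE' F} (hP : P ∈ c.kerDualIsogeny F) : 2 • P = 0 := by
  rw [mem_kerDualIsogeny] at hP
  rcases hP with rfl | rfl
  · simp
  · rw [two_nsmul, torsionPoint_add_self]

end Isogeny

section Selmer

noncomputable instance decidableEqAlgebraicClosure (K : Type*) [Field K] :
    DecidableEq (AlgebraicClosure K) := Classical.decEq _

variable {K : Type} [Field K] [CharZero K]

/-- The action of the absolute Galois group of `K` on the points of `E'` over an algebraic closure
of `K`. -/
noncomputable def galAct (σ : AlgebraicClosure K ≃ₐ[K] AlgebraicClosure K) :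
    c.PointE' (AlgebraicClosure K) →+ c.PointE' (AlgebraicClosure K) :=
  WeierstrassCurve.Affine.Point.map (σ : AlgebraicClosure K →ₐ[K] AlgebraicClosure K)

/-- The map on points of `E'` induced by an embedding of the algebraic closure of `ℚ` into the
algebraic closure of `K`. -/
noncomputable def embPoint (ι : AlgebraicClosure ℚ →ₐ[ℚ] AlgebraicClosure K) :
    c.PointE' (AlgebraicClosure ℚ) →+ c.PointE' (AlgebraicClosure K) :=
  WeierstrassCurve.Affine.Point.map ι

/-- Functions from the absolute Galois group of `ℚ` to the geometric points of `E'`. -/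
abbrev Cochain : Type :=
  (AlgebraicClosure ℚ ≃ₐ[ℚ] AlgebraicClosure ℚ) → c.PointE' (AlgebraicClosure ℚ)

/-- The continuous 1-cocycles of the absolute Galois group of `ℚ` (with its Krull topology) with
values in the discrete module `E'[φ̂]`. -/
noncomputable def cocycles : AddSubgroup c.Cochain where
  carrier := {ξ | (∀ σ, ξ σ ∈ c.kerDualIsogeny (AlgebraicClosure ℚ)) ∧ IsLocallyConstant ξ ∧
    ∀ σ τ, ξ (σ * τ) = ξ σ + c.galAct σ (ξ τ)}
  zero_mem' := ⟨fun _ => zero_mem _, IsLocallyConstant.const 0, by simp⟩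
  add_mem' := by
    rintro ξ η ⟨h1, h2, h3⟩ ⟨k1, k2, k3⟩
    refine ⟨fun σ => add_mem (h1 σ) (k1 σ), h2.add k2, fun σ τ => ?_⟩
    simp only [Pi.add_apply, h3, k3, map_add]
    abel
  neg_mem' := by
    rintro ξ ⟨h1, h2, h3⟩
    refine ⟨fun σ => neg_mem (h1 σ), h2.neg, fun σ τ => ?_⟩
    simp only [Pi.neg_apply, h3, map_neg, neg_add]

/-- The 1-coboundaries `σ ↦ σ P - P` with `P ∈ E'[φ̂]`. -/
noncomputable def coboundaries : AddSubgroup c.Cochain where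
  carrier := {ξ | ∃ P ∈ c.kerDualIsogeny (AlgebraicClosure ℚ), ∀ σ, ξ σ = c.galAct σ P - P}
  zero_mem' := ⟨0, zero_mem _, by simp⟩
  add_mem' := by
    rintro ξ η ⟨P, hP, h⟩ ⟨Q, hQ, k⟩
    refine ⟨P + Q, add_mem hP hQ, fun σ => ?_⟩
    simp only [Pi.add_apply, h, k, map_add]
    abel
  neg_mem' := by
    rintro ξ ⟨P, hP, h⟩
    refine ⟨-P, neg_mem hP, fun σ => ?_⟩
    simp only [Pi.neg_apply, h, map_neg]
    abel

/-- The Galois cohomology group `H¹(ℚ, E'[φ̂])`. -/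
abbrev H1 : Type := c.cocycles ⧸ c.coboundaries.addSubgroupOf c.cocycles

noncomputable instance moduleH1 : Module (ZMod 2) c.H1 :=
  QuotientAddGroup.zmodModule (n := 2) fun ξ => by
    have : 2 • ξ = 0 := by
      ext σ
      exact c.two_nsmul_of_mem (ξ.2.1 σ)
    rw [this]
    exact zero_mem _

variable (K) in
/-- The cocycles whose class dies in `H¹(K, E')`: for every embedding `ι` of the algebraic closure
of `ℚ` into the algebraic closure of `K`, the restriction of the cocycle to the absolute Galois
group of `K` (`τ` is the restriction of `σ` along `ι`), with values moved to the points over the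
algebraic closure of `K`, is a coboundary `σ ↦ σ P - P`. -/
noncomputable def locallyTrivial : AddSubgroup c.Cochain where
  carrier := {ξ | ∀ ι : AlgebraicClosure ℚ →ₐ[ℚ] AlgebraicClosure K,
    ∃ P : c.PointE' (AlgebraicClosure K),
      ∀ (σ : AlgebraicClosure K ≃ₐ[K] AlgebraicClosure K)
        (τ : AlgebraicClosure ℚ ≃ₐ[ℚ] AlgebraicClosure ℚ),
        (∀ x, ι (τ x) = σ (ι x)) → c.embPoint ι (ξ τ) = c.galAct σ P - P}
  zero_mem' := fun _ => ⟨0, by simp⟩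
  add_mem' := by
    intro ξ η h k ι
    obtain ⟨P, hP⟩ := h ι
    obtain ⟨Q, hQ⟩ := k ι
    refine ⟨P + Q, fun σ τ e => ?_⟩
    simp only [Pi.add_apply, map_add, hP σ τ e, hQ σ τ e]
    abel
  neg_mem' := by
    intro ξ h ι
    obtain ⟨P, hP⟩ := h ι
    refine ⟨-P, fun σ τ e => ?_⟩
    simp only [Pi.neg_apply, map_neg, hP σ τ e]
    abel

/-- The Selmer group `S^(φ̂)(E'/ℚ)`: the classes in `H¹(ℚ, E'[φ̂])` that die in `H¹(ℚ_v, E')` for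
every place `v` of `ℚ`, that is, for `ℚ_v = ℝ` and `ℚ_v = ℚ_ℓ` with `ℓ` prime. -/
noncomputable def selmer : AddSubgroup c.H1 :=
  ((c.locallyTrivial ℝ ⊓ ⨅ ℓ : Nat.Primes,
      haveI : Fact (ℓ : ℕ).Prime := ⟨ℓ.2⟩
      c.locallyTrivial ℚ_[(ℓ : ℕ)]).addSubgroupOf c.cocycles).map
    (QuotientAddGroup.mk' (c.coboundaries.addSubgroupOf c.cocycles))

end Selmer

section Kummer

instance isAlgClosureRat : IsAlgClosure ℚ (AlgebraicClosure ℚ) := by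
  have h : (DivisionRing.toRatAlgebra : Algebra ℚ (AlgebraicClosure ℚ)) =
      AlgebraicClosure.instAlgebra ℚ := Subsingleton.elim _ _
  rw [h]
  infer_instance

instance isAlgebraicRat : Algebra.IsAlgebraic ℚ (AlgebraicClosure ℚ) :=
  IsAlgClosure.isAlgebraic

instance isGaloisRat : IsGalois ℚ (AlgebraicClosure ℚ) :=
  haveI := IsAlgClosure.normal ℚ (AlgebraicClosure ℚ)
  ⟨⟩

theorem galAct_torsionPoint (σ : AlgebraicClosure ℚ ≃ₐ[ℚ] AlgebraicClosure ℚ) :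
    c.galAct σ (c.torsionPoint (AlgebraicClosure ℚ)) = c.torsionPoint (AlgebraicClosure ℚ) := by
  simp [galAct, torsionPoint, WeierstrassCurve.Affine.Point.map_some]

theorem galAct_of_mem (σ : AlgebraicClosure ℚ ≃ₐ[ℚ] AlgebraicClosure ℚ)
    {P : c.PointE' (AlgebraicClosure ℚ)} (hP : P ∈ c.kerDualIsogeny (AlgebraicClosure ℚ)) :
    c.galAct σ P = P := by
  rw [mem_kerDualIsogeny] at hP
  rcases hP with rfl | rfl
  · simp
  · exact c.galAct_torsionPoint σ

open Classical in
/-- The Kummer cocycle of `d ∈ ℚˣ` with values in `E'[φ̂] = {O, (0, 0)}`: its value at `σ` is `O` if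
`σ` fixes the square roots of `d`, and `(0, 0)` otherwise. -/
noncomputable def kummerFun (d : ℚˣ) : c.Cochain := fun σ =>
  if ∀ x : AlgebraicClosure ℚ, x ^ 2 = algebraMap ℚ _ (d : ℚ) → σ x = x then 0
  else c.torsionPoint (AlgebraicClosure ℚ)

open Classical in
theorem kummerFun_eq (d : ℚˣ) {r : AlgebraicClosure ℚ} (hr : r ^ 2 = algebraMap ℚ _ (d : ℚ))
    (σ : AlgebraicClosure ℚ ≃ₐ[ℚ] AlgebraicClosure ℚ) :
    c.kummerFun d σ = if σ r = r then 0 else c.torsionPoint (AlgebraicClosure ℚ) := by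
  unfold kummerFun
  refine if_congr ⟨fun h => h r hr, fun h x hx => ?_⟩ rfl rfl
  rcases sq_eq_sq_iff_eq_or_eq_neg.mp (hx.trans hr.symm) with rfl | rfl <;> simp [h]

theorem exists_sqrt (d : ℚˣ) :
    ∃ r : AlgebraicClosure ℚ, r ^ 2 = algebraMap ℚ _ (d : ℚ) ∧ r ≠ 0 := by
  obtain ⟨r, hr⟩ := IsAlgClosed.exists_pow_nat_eq (algebraMap ℚ (AlgebraicClosure ℚ) (d : ℚ))
    (n := 2) two_pos
  refine ⟨r, hr, ?_⟩
  rintro rfl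
  have : algebraMap ℚ (AlgebraicClosure ℚ) (d : ℚ) ≠ 0 := by simp
  exact this (by rw [← hr]; simp)

theorem gal_sqrt {d : ℚˣ} {r : AlgebraicClosure ℚ} (hr : r ^ 2 = algebraMap ℚ _ (d : ℚ))
    (σ : AlgebraicClosure ℚ ≃ₐ[ℚ] AlgebraicClosure ℚ) : σ r = r ∨ σ r = -r := by
  apply sq_eq_sq_iff_eq_or_eq_neg.mp
  rw [← map_pow, hr, AlgEquiv.commutes]

theorem kummerFun_mem (d : ℚˣ) : c.kummerFun d ∈ c.cocycles := by
  obtain ⟨r, hr, h0⟩ := exists_sqrt d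
  have hne : -r ≠ r := fun h => h0 (self_eq_neg.mp h.symm)
  refine ⟨fun σ => ?_, ?_, fun σ τ => ?_⟩
  · rw [mem_kerDualIsogeny, c.kummerFun_eq d hr]
    split_ifs <;> simp
  · rw [IsLocallyConstant.iff_exists_open]
    intro σ
    have : FiniteDimensional ℚ (IntermediateField.adjoin ℚ {r}) :=
      IntermediateField.adjoin.finiteDimensional (Algebra.IsIntegral.isIntegral r)
    refine ⟨_, (IntermediateField.fixingSubgroup_isOpen
      (IntermediateField.adjoin ℚ {r})).leftCoset σ, ?_, ?_⟩
    · exact ⟨1, one_mem _, by simp⟩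
    · rintro _ ⟨g, hg, rfl⟩
      have : g r = r := hg ⟨r, IntermediateField.mem_adjoin_simple_self ℚ r⟩
      rw [c.kummerFun_eq d hr, c.kummerFun_eq d hr]
      simp [this]
  · rw [c.kummerFun_eq d hr, c.kummerFun_eq d hr, c.kummerFun_eq d hr]
    rcases gal_sqrt hr σ with h | h <;> rcases gal_sqrt hr τ with k | k <;>
      simp [h, k, hne, galAct_torsionPoint, torsionPoint_add_self]

theorem kummerFun_mul (d e : ℚˣ) : c.kummerFun (d * e) = c.kummerFun d + c.kummerFun e := by
  obtain ⟨r, hr, h0⟩ := exists_sqrt d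
  obtain ⟨s, hs, k0⟩ := exists_sqrt e
  have hne : -r ≠ r := fun h => h0 (self_eq_neg.mp h.symm)
  have kne : -s ≠ s := fun h => k0 (self_eq_neg.mp h.symm)
  have hrs : (r * s) ^ 2 = algebraMap ℚ _ ((d * e : ℚˣ) : ℚ) := by
    rw [mul_pow, hr, hs, Units.val_mul, map_mul]
  have hrsne : -(r * s) ≠ r * s := fun h => mul_ne_zero h0 k0 (self_eq_neg.mp h.symm)
  ext1 σ
  rw [Pi.add_apply, c.kummerFun_eq _ hrs, c.kummerFun_eq d hr, c.kummerFun_eq e hs]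
  rcases gal_sqrt hr σ with h | h <;> rcases gal_sqrt hs σ with k | k <;>
    simp [h, k, hne, kne, hrsne, torsionPoint_add_self]

/-- The subgroup `ℚˣ²` of squares. -/
def squares : Subgroup ℚˣ := (powMonoidHom 2 : ℚˣ →* ℚˣ).range

/-- The Kummer map `ℚˣ → H¹(ℚ, E'[φ̂])`. -/
noncomputable def kummerHom : ℚˣ →* Multiplicative c.H1 where
  toFun d := Multiplicative.ofAdd (QuotientAddGroup.mk ⟨c.kummerFun d, c.kummerFun_mem d⟩)
  map_one' := by
    have h : (⟨c.kummerFun 1, c.kummerFun_mem 1⟩ : c.cocycles) = 0 := by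
      have := c.kummerFun_mul 1 1
      rw [mul_one, left_eq_add] at this
      exact Subtype.ext this
    rw [h]; rfl
  map_mul' d e := by
    have h : (⟨c.kummerFun (d * e), c.kummerFun_mem (d * e)⟩ : c.cocycles) =
        ⟨c.kummerFun d, c.kummerFun_mem d⟩ + ⟨c.kummerFun e, c.kummerFun_mem e⟩ :=
      Subtype.ext (c.kummerFun_mul d e)
    rw [h]; rfl

/-- The Kummer isomorphism `ℚˣ / ℚˣ² → H¹(ℚ, E'[φ̂])`, through which the Selmer group is regarded as
a subgroup of `ℚˣ / ℚˣ²`. -/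
noncomputable def kummer : (ℚˣ ⧸ squares) →* Multiplicative c.H1 :=
  QuotientGroup.lift squares c.kummerHom (by
    rintro _ ⟨d, rfl⟩
    have h2 : ∀ a : c.H1, a + a = 0 := fun a => by
      rw [← two_nsmul]; exact ZModModule.char_nsmul_eq_zero 2 a
    rw [powMonoidHom_apply, pow_two, MonoidHom.mem_ker, map_mul]
    exact h2 (Multiplicative.toAdd (c.kummerHom d)))

theorem kummer_injective : Function.Injective c.kummer := by
  rw [injective_iff_map_eq_one]
  intro a ha
  induction a using QuotientGroup.induction_on with
  | H d =>
    have h : (QuotientAddGroup.mk ⟨c.kummerFun d, c.kummerFun_mem d⟩ : c.H1) = 0 := ha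
    rw [QuotientAddGroup.eq_zero_iff] at h
    obtain ⟨P, hP, hd⟩ := h
    obtain ⟨r, hr, h0⟩ := exists_sqrt d
    have hfix : ∀ σ : AlgebraicClosure ℚ ≃ₐ[ℚ] AlgebraicClosure ℚ, σ r = r := by
      intro σ
      have h1 : c.kummerFun d σ = 0 := by
        have := hd σ
        rw [c.galAct_of_mem σ hP, sub_self] at this
        exact this
      rw [c.kummerFun_eq d hr] at h1
      by_contra hne
      simp [hne, torsionPoint, WeierstrassCurve.Affine.Point.zero_def] at h1
    have hb := (InfiniteGalois.mem_bot_iff_fixed r).mpr hfix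
    obtain ⟨e, rfl⟩ := IntermediateField.mem_bot.mp hb
    rw [← map_pow] at hr
    have hr' : e ^ 2 = (d : ℚ) := (algebraMap ℚ (AlgebraicClosure ℚ)).injective hr
    have he : e ≠ 0 := by rintro rfl; simp at h0
    rw [QuotientGroup.eq_one_iff]
    exact ⟨Units.mk0 e he, Units.ext hr'⟩

/-- The Selmer group `S^(φ̂)(E'/ℚ)` regarded as a subgroup of `ℚˣ / ℚˣ²`. -/
noncomputable def selmerInSquareClasses : Subgroup (ℚˣ ⧸ squares) :=
  (AddSubgroup.toSubgroup c.selmer).comap c.kummer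

end Kummer

section Invariants

/-- `Πᵢ⁺(D')` for `i = 1, …, n`. -/
def PiTerm (i : Fin n) : ℤ :=
  (1 - legendreSym (c.D i) (-(c.q : ℤ) * c.hatD i)) *
      (1 - legendreSym (c.D i) (-(c.p : ℤ) * c.hatD i)) +
    ∑ j ∈ Finset.univ.erase i,
      (1 - legendreSym (c.D j) (c.D i)) * (1 - legendreSym (c.D j) ((c.p : ℤ) * c.q * c.D i))

/-- The condition under which `δ'ₙ₊₁ = 0`. -/
def DeltaCond : Prop :=
  (c.m = 2 ∧ ¬ (c.p : ℤ) - c.prodD ≡ 2 [ZMOD 8]) ∨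
  (c.m = 3 ∧ (c.p : ℤ) - c.prodD ≡ 0 [ZMOD 4]) ∨
  (4 ≤ c.m ∧ (c.p : ℤ) - c.prodD ≡ 0 [ZMOD 8])

open Classical in
/-- `δ'ₙ₊₁`. -/
noncomputable def delta : ℤ := if c.DeltaCond then 0 else 1

/-- `Πₙ₊₁⁺(D')`. -/
noncomputable def PiLast : ℤ :=
  c.delta + ∑ i, (1 - legendreSym (c.D i) (-1)) *
    (1 - legendreSym (c.D i) (-((c.p : ℤ) * c.q)))

/-- Membership of an index in `I`, for `m ≥ 2`. -/
def InI (i : Fin n) : Prop :=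
  (c.m = 2 ∧
    ((c.D i : ℤ) ≡ 1 [ZMOD 4] ∨
      (c.D i : ℤ) + c.p * c.prodD ≡ 0 [ZMOD 4] ∨
      ((c.D i : ℤ) ≡ 3 [ZMOD 4] ∧ (c.p : ℤ) - c.prodD ≡ 6 [ZMOD 8]))) ∨
  (c.m = 3 ∧
    ((c.D i : ℤ) ≡ 1 [ZMOD 8] ∨
      (c.D i : ℤ) + c.p * c.prodD ≡ 0 [ZMOD 8] ∨
      ((c.D i : ℤ) ≡ 3 [ZMOD 4] ∧ (c.p : ℤ) * c.prodD + c.D i ≡ 4 [ZMOD 8]) ∨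
      ((c.D i : ℤ) ≡ 5 [ZMOD 8] ∧ (c.p : ℤ) * c.prodD - c.D i ≡ 0 [ZMOD 4]))) ∨
  (c.m = 4 ∧
    ((c.D i : ℤ) ≡ 1 [ZMOD 8] ∨
      (c.D i : ℤ) + c.p * c.prodD ≡ 0 [ZMOD 8] ∨
      ((c.D i : ℤ) ≡ 5 [ZMOD 8] ∧ (c.p : ℤ) * c.prodD + c.D i ≡ 4 [ZMOD 8]))) ∨
  (5 ≤ c.m ∧
    ((c.D i : ℤ) ≡ 1 [ZMOD 8] ∨
      (c.D i : ℤ) + c.p * c.prodD ≡ 0 [ZMOD 8]))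

open Classical in
/-- The index set `I ⊆ {1, …, n}`. -/
noncomputable def setI : Finset (Fin n) := Finset.univ.filter c.InI

/-- `ρ⁺(D') = ∑_{i ∈ I ∪ {n+1}} ⌊1 / (1 + Πᵢ⁺(D'))⌋` (all `Πᵢ⁺(D')` are nonnegative). -/
noncomputable def rho : ℕ :=
  ∑ i ∈ c.setI, ⌊(1 : ℚ) / (1 + (c.PiTerm i : ℚ))⌋₊ + ⌊(1 : ℚ) / (1 + (c.PiLast : ℚ))⌋₊

end Invariants

end FamilyData

/-! The class of `d` dies in `H¹(K, E')` as soon as the torsor `d w² = (d z² + pD)(d z² + qD)` has a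
`K`-point: such a point gives the rational point `(d z², d z w)` of `E`, and the Galois action on a
preimage under `φ̂` is the Kummer cocycle of `d` (`kummerFun_mem_locallyTrivial`). With `x = d z²`,
the task is to find `x` with `d x` and `d (x + pD)(x + qD)` both squares (`mem_localKernel`). Points
at infinity and the three 2-torsion points of `E` give four sufficient conditions: `d`, `d p q`, `-d
p D` or `-d q D` is a square.

At the real place one of these always holds. At an odd prime not dividing `D`, every integral `d`
prime to it is locally trivial: if no sufficient condition applies, a residue-field point lifts by
Hensel's lemma. It comes from a character sum at good primes and from a square followed by a
non-square at `p` and `q`. At the primes dividing `D`, the vanishing of the matching summand of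
`Πᵢ⁺` is one of the four conditions. At `2`, the congruences defining `I` and `δ'` provide either
such a condition or an explicit integral point modulo squares of units.

All summands of `Πᵢ⁺` are nonnegative integers, so `⌊1 / (1 + Πᵢ⁺)⌋` is the indicator of `Πᵢ⁺ = 0`.
Thus `ρ⁺` counts generators among `-1, D₁, …, Dₙ` that lie in the Selmer group; sign and parities of
valuations show that they are independent modulo squares. -/

namespace FamilyData

variable {n : ℕ} (c : FamilyData n)

/-! ### Local triviality from points on the homogeneous space. -/

section LocalCriterion

instance curveE'_isElliptic : c.curveE'.IsElliptic := by
  refine ⟨isUnit_iff_ne_zero.mpr ?_⟩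
  have h : c.curveE'.Δ = 16 * ((4 : ℚ) ^ c.m * (c.prodD : ℚ) ^ 2) ^ 2 *
      (16 * ((c.p : ℚ) * c.q * (c.prodD : ℚ) ^ 2)) := by
    simp only [WeierstrassCurve.Δ, WeierstrassCurve.b₂, WeierstrassCurve.b₄, WeierstrassCurve.b₆,
      WeierstrassCurve.b₈, curveE', c.four_pow]
    ring
  rw [h]
  have := c.prodD_ne_zero
  have := c.p_ne_zero
  have := c.q_ne_zero
  positivity

theorem four_pow_field (F : Type*) [Field F] : (4 : F) ^ c.m = ((c.q : F) - c.p) ^ 2 := by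
  have h : (c.q : F) = c.p + 2 ^ c.m := by exact_mod_cast congrArg (Nat.cast : ℕ → F) c.q_eq
  rw [h, add_sub_cancel_left, ← pow_mul, mul_comm, pow_mul]; norm_num

theorem nonsingular_curveE' {F : Type*} [Field F] [CharZero F] {x y : F}
    (h : y ^ 2 = x ^ 3 - 2 * ((c.p : F) + c.q) * c.prodD * x ^ 2 +
      4 ^ c.m * (c.prodD : F) ^ 2 * x) :
    (c.curveE'.baseChange F).toAffine.Nonsingular x y := by
  have : (c.curveE'.baseChange F).toAffine.IsElliptic :=
    inferInstanceAs ((c.curveE'.map (algebraMap ℚ F)).IsElliptic)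
  rw [← WeierstrassCurve.Affine.equation_iff_nonsingular, WeierstrassCurve.Affine.equation_iff]
  simp [curveE', WeierstrassCurve.baseChange, WeierstrassCurve.map, h]
  ring

/-- The translate of `(x, y)` by `(0, 0)` on `E'` is `(4 ^ m D² / x, -4 ^ m D² y / x²)`. -/
theorem sub_eq_torsionPoint {F : Type*} [Field F] [CharZero F] [DecidableEq F] {x y x' y' : F}
    (hx : x ≠ 0) (h : (c.curveE'.baseChange F).toAffine.Nonsingular x y)
    (h' : (c.curveE'.baseChange F).toAffine.Nonsingular x' y')
    (hx' : x' = 4 ^ c.m * (c.prodD : F) ^ 2 / x)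
    (hy' : y' = -(4 ^ c.m * (c.prodD : F) ^ 2 * y / x ^ 2)) :
    (.some _ _ h' : c.PointE' F) - .some x y h = c.torsionPoint F := by
  subst hx' hy'
  rw [sub_eq_iff_eq_add', torsionPoint, WeierstrassCurve.Affine.Point.add_of_X_ne hx,
    WeierstrassCurve.Affine.Point.some.injEq]
  have e := c.equation_curveE' h.1
  rw [WeierstrassCurve.Affine.slope_of_X_ne hx]
  simp only [WeierstrassCurve.Affine.addX, sub_zero, WeierstrassCurve.baseChange, curveE',
    neg_add_rev, WeierstrassCurve.map_a₁, map_zero, zero_mul, add_zero, WeierstrassCurve.map_a₂,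
    map_mul, map_add, map_neg, map_ofNat, map_natCast, WeierstrassCurve.Affine.addY,
    WeierstrassCurve.Affine.negY, WeierstrassCurve.Affine.negAddY, WeierstrassCurve.map_a₃]
  constructor
  · field_simp
    linear_combination -e
  · field_simp
    linear_combination y * e

/-- The local image of the connecting map: `d` is locally trivial over `K` as soon as the
homogeneous space `d w² = (d z² + p D) (d z² + q D)` has an affine point over `K`. -/
theorem kummerFun_mem_locallyTrivial {K : Type} [Field K] [CharZero K] (d : ℚˣ) (z w : K)
    (h : ((d : ℚ) : K) * w ^ 2 = (((d : ℚ) : K) * z ^ 2 + c.p * c.prodD) *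
      (((d : ℚ) : K) * z ^ 2 + c.q * c.prodD)) :
    c.kummerFun d ∈ c.locallyTrivial K := by
  intro ι
  obtain ⟨r, hr, -⟩ := exists_sqrt d
  let f : K →+* AlgebraicClosure K := algebraMap K (AlgebraicClosure K)
  have hs : (ι r) ^ 2 = f ((d : ℚ) : K) := by
    rw [← map_pow, hr]; simp
  set s := ι r with hsdef
  have hf := congrArg f h
  simp only [map_mul, map_pow, map_add, map_natCast, ← hs] at hf
  set P := (c.p : AlgebraicClosure K) with hP
  set Q := (c.q : AlgebraicClosure K) with hQ
  set D := (c.prodD : AlgebraicClosure K) with hD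
  have hD0 : D ≠ 0 := by
    have := c.prodD_ne_zero
    rw [hD]; exact_mod_cast this
  have hPQ : (4 : AlgebraicClosure K) ^ c.m = (Q - P) ^ 2 := c.four_pow_field _
  have hPQ0 : (Q - P) ^ 2 ≠ 0 := by
    rw [← hPQ]; exact pow_ne_zero _ (by norm_num)
  -- `X s` is the abscissa of a point of `E'` above `(d z², d z w)`. Since `X s * X (-s) = 4 ^ m
  -- D²`, replacing `s` by `-s` is translation by `(0, 0)`.
  let X : AlgebraicClosure K → AlgebraicClosure K :=
    fun t => 2 * t ^ 2 * (f z) ^ 2 + (P + Q) * D - 2 * t * f w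
  have hXX : X (-s) * X s = (Q - P) ^ 2 * D ^ 2 := by
    linear_combination -4 * hf
  have hX0 : X s ≠ 0 := by
    intro e
    rw [e, mul_zero] at hXX
    exact mul_ne_zero hPQ0 (pow_ne_zero 2 hD0) hXX.symm
  have key : ∀ t : AlgebraicClosure K, t ^ 2 = s ^ 2 →
      (2 * t * f z * X t) ^ 2 = X t ^ 3 - 2 * (P + Q) * D * X t ^ 2 + 4 ^ c.m * D ^ 2 * X t := by
    intro t ht
    rw [hPQ]
    have hf' : t ^ 2 * f w ^ 2 = (t ^ 2 * f z ^ 2 + P * D) * (t ^ 2 * f z ^ 2 + Q * D) := by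
      rw [ht]; exact hf
    simp only [X]
    linear_combination
      (-4) * (2 * t ^ 2 * (f z) ^ 2 + (P + Q) * D - 2 * t * f w) * hf'
  refine ⟨.some (X s) (2 * s * f z * X s) (c.nonsingular_curveE' (key s rfl)), ?_⟩
  intro σ τ hστ
  have hσf : ∀ a, σ (f a) = f a := fun a => σ.commutes a
  have hσ2 : σ 2 = 2 := map_ofNat σ 2
  have hσX : σ (X s) = X (σ s) := by
    simp [X, hσf, hσ2, hP, hQ, hD]
  have hgal : c.galAct σ (.some (X s) (2 * s * f z * X s) (c.nonsingular_curveE' (key s rfl))) =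
      .some (X (σ s)) (2 * σ s * f z * X (σ s)) (c.nonsingular_curveE' (key (σ s) (by
        rw [← map_pow, hs, hσf]))) := by
    rw [galAct, WeierstrassCurve.Affine.Point.map_some, WeierstrassCurve.Affine.Point.some.injEq]
    simp [hσX, hσf, hσ2]
  rw [hgal, c.kummerFun_eq d hr]
  split_ifs with hτ
  · have : σ s = s := by rw [hsdef, ← hστ, hτ]
    simp [this]
  · have hneg : σ s = -s := by
      rw [hsdef, ← hστ, (gal_sqrt hr τ).resolve_left hτ, map_neg]
    have hX' : X (σ s) = 4 ^ c.m * D ^ 2 / X s := by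
      rw [eq_div_iff hX0, hneg, hPQ, hXX]
    rw [c.sub_eq_torsionPoint hX0 _ _ hX']
    · simp [embPoint, torsionPoint, WeierstrassCurve.Affine.Point.map_some]
    · rw [hX', hneg]
      rw [← hD]
      field_simp

/-- This is the case of the points at infinity of the homogeneous space, which the affine criterion
omits: the Galois group of `K` fixes `√d`, so the restricted cocycle is zero. -/
theorem kummerFun_mem_locallyTrivial_of_isSquare {K : Type} [Field K] [CharZero K] (d : ℚˣ)
    (h : IsSquare ((d : ℚ) : K)) : c.kummerFun d ∈ c.locallyTrivial K := by
  intro ι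
  refine ⟨0, fun σ τ hστ => ?_⟩
  obtain ⟨a, ha⟩ := h
  obtain ⟨r, hr, -⟩ := exists_sqrt d
  have hs : (ι r) ^ 2 = (algebraMap K (AlgebraicClosure K) a) ^ 2 := by
    rw [← map_pow, hr, ← map_pow, pow_two a, ← ha]; simp
  have hσ : σ (ι r) = ι r := by
    rcases sq_eq_sq_iff_eq_or_eq_neg.mp hs with e | e <;> simp [e]
  have hτ : τ r = r := ι.injective ((hστ r).trans hσ)
  simp [c.kummerFun_eq d hr, hτ]

variable (K : Type) [Field K] [CharZero K]

/-- The group of `d ∈ ℚˣ` whose Kummer class dies in `H¹(K, E')`. -/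
noncomputable def localKernel : Subgroup ℚˣ where
  carrier := {d | c.kummerFun d ∈ c.locallyTrivial K}
  one_mem' := c.kummerFun_mem_locallyTrivial_of_isSquare 1 (by simp)
  mul_mem' := by
    intro d e hd he
    rw [Set.mem_ofPred_eq, kummerFun_mul]
    exact add_mem hd he
  inv_mem' := by
    intro d hd
    have h1 : c.kummerFun (d⁻¹ * d⁻¹) = 0 := by
      rw [kummerFun_mul]
      ext1 σ
      rw [Pi.add_apply, ← two_nsmul]
      exact c.two_nsmul_of_mem ((c.kummerFun_mem d⁻¹).1 σ)
    have h2 : d⁻¹ = d * (d⁻¹ * d⁻¹) := by group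
    rw [Set.mem_ofPred_eq, h2, kummerFun_mul, h1, add_zero]
    exact hd

variable {K} {c}

theorem mem_localKernel_of_isSquare {d : ℚˣ} (h : IsSquare ((d : ℚ) : K)) :
    d ∈ c.localKernel K :=
  c.kummerFun_mem_locallyTrivial_of_isSquare d h

/-- The affine criterion with `x = d z²`. The next three results take `x` to be the abscissa of a
2-torsion point of `E`, namely `0`, `-pD`, `-qD`. -/
theorem mem_localKernel {d : ℚˣ} {x : K} (h1 : IsSquare (((d : ℚ) : K) * x))
    (h2 : IsSquare (((d : ℚ) : K) * ((x + c.p * c.prodD) * (x + c.q * c.prodD)))) :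
    d ∈ c.localKernel K := by
  have hd : ((d : ℚ) : K) ≠ 0 := by simp
  obtain ⟨a, ha⟩ := h1
  obtain ⟨b, hb⟩ := h2
  refine c.kummerFun_mem_locallyTrivial d (a / ((d : ℚ) : K)) (b / ((d : ℚ) : K)) ?_
  have hx : ((d : ℚ) : K) * (a / ((d : ℚ) : K)) ^ 2 = x := by
    field_simp
    rw [pow_two, ← ha]
  rw [hx]
  field_simp
  linear_combination -hb

theorem mem_localKernel_of_isSquare_pq {d : ℚˣ} (h : IsSquare (((d : ℚ) : K) * (c.p * c.q))) :
    d ∈ c.localKernel K := by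
  refine mem_localKernel (x := 0) (by simp) ?_
  obtain ⟨a, ha⟩ := h
  exact ⟨a * c.prodD, by linear_combination (c.prodD : K) ^ 2 * ha⟩

theorem mem_localKernel_of_isSquare_neg_p {d : ℚˣ}
    (h : IsSquare (((d : ℚ) : K) * -(c.p * c.prodD))) : d ∈ c.localKernel K :=
  mem_localKernel h (by simp)

theorem mem_localKernel_of_isSquare_neg_q {d : ℚˣ}
    (h : IsSquare (((d : ℚ) : K) * -(c.q * c.prodD))) : d ∈ c.localKernel K :=
  mem_localKernel h (by simp)

end LocalCriterion
end FamilyData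

/-! ### Squares in `ℚ_l` by Hensel's lemma. -/

section PadicSquares

open Polynomial in
theorem PadicInt.isSquare_of_norm_sub_lt {l : ℕ} [Fact l.Prime] {a b : ℤ_[l]}
    (h : ‖b ^ 2 - a‖ < ‖2 * b‖ ^ 2) : IsSquare a := by
  have h' : ‖(X ^ 2 - C a : ℤ_[l][X]).aeval b‖ <
      ‖(X ^ 2 - C a : ℤ_[l][X]).derivative.aeval b‖ ^ 2 := by
    simpa [← two_mul, one_add_one_eq_two] using h
  obtain ⟨z, hz, -⟩ := hensels_lemma h'
  refine ⟨z, ?_⟩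
  simp only [map_sub, map_pow, aeval_X, aeval_C, Algebra.algebraMap_self, RingHom.id_apply,
    sub_eq_zero] at hz
  rw [← hz, pow_two]

theorem Padic.isSquare_intCast {l : ℕ} [Fact l.Prime] (hl : l ≠ 2) {a : ℤ}
    (h0 : (a : ZMod l) ≠ 0) (h : IsSquare (a : ZMod l)) : IsSquare (a : ℚ_[l]) := by
  obtain ⟨b, hb⟩ := h
  obtain ⟨b, rfl⟩ := ZMod.intCast_surjective b
  have hdvd : (l : ℤ) ∣ b ^ 2 - a := by
    rw [← ZMod.intCast_zmod_eq_zero_iff_dvd]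
    push_cast
    rw [hb]; ring
  have hndvd : ¬ (l : ℤ) ∣ 2 * b := by
    rw [← ZMod.intCast_zmod_eq_zero_iff_dvd]
    push_cast
    refine mul_ne_zero ?_ ?_
    · have : Fact (2 < l) := ⟨lt_of_le_of_ne (Fact.out : l.Prime).two_le (Ne.symm hl)⟩
      exact (ZMod.neg_one_ne_one (n := l)).symm ∘ fun e => by linear_combination e
    · rintro e
      rw [e] at hb
      exact h0 (by rw [hb, mul_zero])
  have : IsSquare (a : ℤ_[l]) := by
    refine PadicInt.isSquare_of_norm_sub_lt (b := b) ?_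
    have h1 : ‖((2 * b : ℤ) : ℤ_[l])‖ = 1 :=
      le_antisymm (PadicInt.norm_le_one _)
        (not_lt.mp fun h => hndvd (PadicInt.norm_int_lt_one_iff_dvd _ |>.mp h))
    have h2 : ‖((b ^ 2 - a : ℤ) : ℤ_[l])‖ < 1 := (PadicInt.norm_int_lt_one_iff_dvd _).mpr hdvd
    push_cast at h1 h2
    rw [h1]; simpa using h2
  obtain ⟨z, hz⟩ := this
  exact ⟨z, by rw [← PadicInt.coe_mul, ← hz]; simp⟩

theorem Padic.isSquare_intCast_two {a : ℤ} (h : a ≡ 1 [ZMOD 8]) : IsSquare (a : ℚ_[2]) := by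
  have : IsSquare (a : ℤ_[2]) := by
    -- Hensel at `b = 1` needs `|1 - a| < |2|² = 1/4`, and `8 ∣ 1 - a` gives `1/8`.
    refine PadicInt.isSquare_of_norm_sub_lt (b := 1) ?_
    have h2 : ‖((1 - a : ℤ) : ℤ_[2])‖ ≤ (2 : ℕ) ^ (-(3 : ℕ) : ℤ) := by
      rw [PadicInt.norm_int_le_pow_iff_dvd]
      exact h.dvd
    have h3 : ‖(2 : ℤ_[2])‖ = 2⁻¹ := by
      simpa using PadicInt.norm_p (p := 2)
    push_cast at h2
    rw [mul_one, one_pow, h3]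
    refine h2.trans_lt (by norm_num)
  obtain ⟨z, hz⟩ := this
  exact ⟨z, by rw [← PadicInt.coe_mul, ← hz]; simp⟩

end PadicSquares

/-! ### Character sums and residue-field points. -/

section QuadraticCharacter

open Finset

variable {F : Type*} [Field F] [Fintype F] [DecidableEq F]

/-- For `x ≠ 0` the character of `x (x + C) = x² (1 + C / x)` is that of `1 + C / x`. With `0⁻¹ = 0`
the map `x ↦ 1 + C x⁻¹` permutes `F`, and the value `1` taken at `x = 0` is the one missing from a
full character sum of `0`. -/
theorem quadraticChar_sum_mul_add (hF : ringChar F ≠ 2) {C : F} (hC : C ≠ 0) :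
    ∑ x : F, quadraticChar F (x * (x + C)) = -1 := by
  have h1 : ∑ x : F, quadraticChar F (x * (x + C)) =
      ∑ x ∈ univ.erase (0 : F), quadraticChar F (1 + C * x⁻¹) := by
    rw [← add_sum_erase univ _ (mem_univ (0 : F))]
    simp only [zero_mul, MulChar.map_zero, zero_add]
    refine sum_congr rfl fun x hx => ?_
    have hx0 : x ≠ 0 := ne_of_mem_erase hx
    have : x * (x + C) = x ^ 2 * (1 + C * x⁻¹) := by field_simp
    rw [this, map_mul, quadraticChar_sq_one' hx0, one_mul]
  have h2 : ∑ x : F, quadraticChar F (1 + C * x⁻¹) = ∑ x : F, quadraticChar F x :=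
    Fintype.sum_bijective (fun x => 1 + C * x⁻¹)
      (((Equiv.addLeft 1).bijective.comp (Equiv.mulLeft₀ C hC).bijective).comp
        inv_involutive.bijective) _ _ fun x => rfl
  rw [quadraticChar_sum_zero hF, ← add_sum_erase univ _ (mem_univ (0 : F))] at h2
  rw [inv_zero, mul_zero, add_zero, map_one] at h2
  rw [h1]
  linarith

/-- The quadratic twist by a non-square of the genus one curve attached to `x (x + A) (x + B)` has
a point over a finite field, provided that `-A` and `-B` are squares. -/
theorem exists_quadraticChar_eq_neg_one (hF : ringChar F ≠ 2) {A B : F} (hA : A ≠ 0) (hB : B ≠ 0)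
    (hAB : A ≠ B) (hA' : IsSquare (-A)) (hB' : IsSquare (-B)) :
    ∃ x : F, quadraticChar F x = -1 ∧ quadraticChar F ((x + A) * (x + B)) = -1 := by
  by_contra! H
  have cA : quadraticChar F (-A) = 1 := (quadraticChar_one_iff_isSquare (neg_ne_zero.mpr hA)).mpr hA'
  have cB : quadraticChar F (-B) = 1 := (quadraticChar_one_iff_isSquare (neg_ne_zero.mpr hB)).mpr hB'
  -- Absence of a solution kills this product everywhere; squareness of `-A` and `-B` covers `x = 0,
  -- -A, -B`. Summed over `x`, the product equals `N + 1`, where `N ≥ 0` counts the affine points of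
  -- `y² = x (x + A)(x + B)`, a contradiction.
  have hzero : ∀ x : F, (1 - quadraticChar F x) * (1 - quadraticChar F ((x + A) * (x + B))) = 0 := by
    intro x
    rcases eq_or_ne x 0 with rfl | hx
    · have : (0 + A) * (0 + B) = -A * -B := by ring
      rw [this, map_mul, cA, cB]; simp
    rcases quadraticChar_dichotomy hx with h | h
    · simp [h]
    · have h1 := H x h
      by_cases h0 : (x + A) * (x + B) = 0
      · exfalso
        rcases mul_eq_zero.mp h0 with e | e
        · rw [eq_neg_of_add_eq_zero_left e, cA] at h; norm_num at h
        · rw [eq_neg_of_add_eq_zero_left e, cB] at h; norm_num at h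
      · rw [(quadraticChar_dichotomy h0).resolve_right h1]; simp
  have hsum : ∑ x : F, (1 - quadraticChar F x) *
      (1 - quadraticChar F ((x + A) * (x + B))) = 0 := sum_eq_zero fun x _ => hzero x
  have hshift : ∑ x : F, quadraticChar F ((x + A) * (x + B)) = -1 := by
    rw [← quadraticChar_sum_mul_add hF (sub_ne_zero.mpr hAB.symm)]
    exact Fintype.sum_bijective (fun x => x + A) (Equiv.addRight A).bijective _ _
      fun x => by congr 1; ring
  have hnonneg : 0 ≤ ∑ x : F, (1 + quadraticChar F (x * ((x + A) * (x + B)))) :=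
    sum_nonneg fun x _ => by
      rcases eq_or_ne (x * ((x + A) * (x + B))) 0 with h | h
      · simp [h]
      · rcases quadraticChar_dichotomy h with h | h <;> simp [h]
  have hexp : ∑ x : F, (1 - quadraticChar F x) * (1 - quadraticChar F ((x + A) * (x + B))) =
      ∑ x : F, (1 + quadraticChar F (x * ((x + A) * (x + B)))) - ∑ x : F, quadraticChar F x -
        ∑ x : F, quadraticChar F ((x + A) * (x + B)) := by
    rw [← sum_sub_distrib, ← sum_sub_distrib]
    refine sum_congr rfl fun x _ => ?_
    rw [map_mul _ x]; ring
  rw [hsum, quadraticChar_sum_zero hF, hshift] at hexp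
  linarith

/-- Modulo an odd prime, some non-zero square is followed by a non-square. -/
theorem ZMod.exists_consecutive {l : ℕ} [Fact l.Prime] (hl : l ≠ 2) :
    ∃ k : ZMod l, k ≠ 0 ∧ IsSquare k ∧ ¬ IsSquare (k + 1) := by
  by_contra! H
  obtain ⟨a, ha⟩ := quadraticChar_exists_neg_one (F := ZMod l) (by rwa [ZMod.ringChar_zmod_n])
  rw [quadraticChar_neg_one_iff_not_isSquare] at ha
  -- Otherwise squareness would propagate from `0` and `1` to all residues.
  have : ∀ k : ℕ, IsSquare (k : ZMod l) := by
    intro k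
    induction k with
    | zero => simp
    | succ k ih =>
      by_cases hk : (k : ZMod l) = 0
      · simp [hk]
      · push_cast
        exact H _ hk ih
  exact ha (by simpa using this a.val)

end QuadraticCharacter

namespace FamilyData

variable {n : ℕ} {c : FamilyData n}

/-! ### The odd primes and the real place. -/

section OddPlaces

theorem isSquare_mul_of_not_isSquare {F : Type*} [Field F] [Fintype F] {a b : F}
    (ha : ¬IsSquare a) (hb : ¬IsSquare b) : IsSquare (a * b) := by
  classical
  by_contra h
  rw [← quadraticChar_neg_one_iff_not_isSquare] at ha hb h
  rw [map_mul, ha, hb] at h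
  norm_num at h

theorem not_isSquare_mul_of_isSquare {F : Type*} [Field F] {a b : F}
    (ha : ¬IsSquare a) (hb : IsSquare b) (hb0 : b ≠ 0) : ¬IsSquare (a * b) := fun h =>
  ha (by simpa [hb0] using h.div hb)

theorem mem_localKernel_intCast {K : Type} [Field K] [CharZero K] {d : ℚˣ} {δ : ℤ}
    (hd : (d : ℚ) = δ) {x : ℤ} (h1 : IsSquare ((δ * x : ℤ) : K))
    (h2 : IsSquare ((δ * ((x + c.p * c.prodD) * (x + c.q * c.prodD)) : ℤ) : K)) :
    d ∈ c.localKernel K := by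
  refine mem_localKernel (x := (x : K)) ?_ ?_
  · simpa [hd] using h1
  · simpa [hd] using h2

variable {l : ℕ} [Fact l.Prime] {d : ℚˣ} {δ : ℤ}

theorem mem_localKernel_of_isSquare_zmod (hl : l ≠ 2) (hd : (d : ℚ) = δ) (h0 : (δ : ZMod l) ≠ 0)
    (h : IsSquare (δ : ZMod l)) : d ∈ c.localKernel ℚ_[l] := by
  refine mem_localKernel_of_isSquare ?_
  simpa [hd] using Padic.isSquare_intCast hl h0 h

theorem mem_localKernel_of_not_isSquare_neg_p (hl : l ≠ 2) (hd : (d : ℚ) = δ)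
    (h : ¬IsSquare (δ : ZMod l)) (h' : ¬IsSquare (-(c.p * c.prodD) : ZMod l)) :
    d ∈ c.localKernel ℚ_[l] := by
  have h0 : (δ : ZMod l) ≠ 0 := by rintro e; simp [e] at h
  have h0' : (-(c.p * c.prodD) : ZMod l) ≠ 0 := by rintro e; simp [e] at h'
  refine mem_localKernel_of_isSquare_neg_p ?_
  have := Padic.isSquare_intCast hl (a := δ * -(c.p * c.prodD))
    (by push_cast; exact mul_ne_zero h0 h0')
    (by push_cast; exact isSquare_mul_of_not_isSquare h h')
  simpa [hd] using this

theorem mem_localKernel_of_not_isSquare_neg_q (hl : l ≠ 2) (hd : (d : ℚ) = δ)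
    (h : ¬IsSquare (δ : ZMod l)) (h' : ¬IsSquare (-(c.q * c.prodD) : ZMod l)) :
    d ∈ c.localKernel ℚ_[l] := by
  have h0 : (δ : ZMod l) ≠ 0 := by rintro e; simp [e] at h
  have h0' : (-(c.q * c.prodD) : ZMod l) ≠ 0 := by rintro e; simp [e] at h'
  refine mem_localKernel_of_isSquare_neg_q ?_
  have := Padic.isSquare_intCast hl (a := δ * -(c.q * c.prodD))
    (by push_cast; exact mul_ne_zero h0 h0')
    (by push_cast; exact isSquare_mul_of_not_isSquare h h')
  simpa [hd] using this

theorem mem_localKernel_of_not_isSquare (hl : l ≠ 2) (hd : (d : ℚ) = δ)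
    (h : ¬IsSquare (δ : ZMod l)) {x : ZMod l} (h1 : ¬IsSquare x)
    (h2 : ¬IsSquare ((x + c.p * c.prodD) * (x + c.q * c.prodD))) :
    d ∈ c.localKernel ℚ_[l] := by
  obtain ⟨x, rfl⟩ := ZMod.intCast_surjective x
  have h0 : (δ : ZMod l) ≠ 0 := by rintro e; simp [e] at h
  have h10 : (x : ZMod l) ≠ 0 := by rintro e; simp [e] at h1
  have h20 : ((x : ZMod l) + c.p * c.prodD) * (x + c.q * c.prodD) ≠ 0 := by
    rintro e; simp [e] at h2
  refine mem_localKernel_intCast hd (x := x) (Padic.isSquare_intCast hl ?_ ?_)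
    (Padic.isSquare_intCast hl ?_ ?_) <;> push_cast
  · exact mul_ne_zero h0 h10
  · exact isSquare_mul_of_not_isSquare h h1
  · exact mul_ne_zero h0 h20
  · exact isSquare_mul_of_not_isSquare h h2

/-- For a non-residue `δ`, a 2-torsion point suffices unless `-pD` and `-qD` are both residues; this
exception is exactly the hypothesis of the character sum argument. -/
theorem mem_localKernel_of_good (hl : l ≠ 2) (hp : (c.p : ZMod l) ≠ 0) (hq : (c.q : ZMod l) ≠ 0)
    (hD : (c.prodD : ZMod l) ≠ 0) (hd : (d : ℚ) = δ) (h0 : (δ : ZMod l) ≠ 0) :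
    d ∈ c.localKernel ℚ_[l] := by
  by_cases hs : IsSquare (δ : ZMod l)
  · exact mem_localKernel_of_isSquare_zmod hl hd h0 hs
  by_cases hA : IsSquare (-(c.p * c.prodD) : ZMod l)
  swap
  · exact mem_localKernel_of_not_isSquare_neg_p hl hd hs hA
  by_cases hB : IsSquare (-(c.q * c.prodD) : ZMod l)
  swap
  · exact mem_localKernel_of_not_isSquare_neg_q hl hd hs hB
  have hAB : (c.p * c.prodD : ZMod l) ≠ c.q * c.prodD := by
    intro e
    have e' := mul_right_cancel₀ hD e
    rw [c.q_eq] at e'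
    push_cast at e'
    rw [left_eq_add] at e'
    have h2 : (2 : ZMod l) = 0 := eq_zero_of_pow_eq_zero e'
    have h2' : ((2 : ℕ) : ZMod l) = 0 := by exact_mod_cast h2
    rw [ZMod.natCast_eq_zero_iff] at h2'
    exact hl ((Nat.prime_dvd_prime_iff_eq Fact.out Nat.prime_two).mp h2')
  obtain ⟨x, h1, h2⟩ := exists_quadraticChar_eq_neg_one (by rwa [ZMod.ringChar_zmod_n])
    (mul_ne_zero hp hD) (mul_ne_zero hq hD) hAB hA hB
  rw [quadraticChar_neg_one_iff_not_isSquare] at h1 h2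
  exact mem_localKernel_of_not_isSquare hl hd hs h1 h2

/-- Modulo `p` the second factor becomes `x (x + qD)`. When `B = -qD` is a square, `x = (k + 1) B`
with `k` a non-zero square and `k + 1` a non-square makes `x` a non-square and `x + qD = k B` a
non-zero square. -/
theorem mem_localKernel_of_p (hl : l ≠ 2) (hp : (c.p : ZMod l) = 0) (hq : (c.q : ZMod l) ≠ 0)
    (hD : (c.prodD : ZMod l) ≠ 0) (hd : (d : ℚ) = δ) (h0 : (δ : ZMod l) ≠ 0) :
    d ∈ c.localKernel ℚ_[l] := by
  by_cases hs : IsSquare (δ : ZMod l)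
  · exact mem_localKernel_of_isSquare_zmod hl hd h0 hs
  by_cases hB : IsSquare (-(c.q * c.prodD) : ZMod l)
  swap
  · exact mem_localKernel_of_not_isSquare_neg_q hl hd hs hB
  have hB0 := neg_ne_zero.mpr (mul_ne_zero hq hD)
  obtain ⟨k, hk0, hk, hk1⟩ := ZMod.exists_consecutive hl
  have hx := not_isSquare_mul_of_isSquare hk1 hB hB0
  refine mem_localKernel_of_not_isSquare hl hd hs hx ?_
  have := not_isSquare_mul_of_isSquare hx (hk.mul hB) (mul_ne_zero hk0 hB0)
  convert this using 2
  rw [hp]; ring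

theorem mem_localKernel_of_q (hl : l ≠ 2) (hp : (c.p : ZMod l) ≠ 0) (hq : (c.q : ZMod l) = 0)
    (hD : (c.prodD : ZMod l) ≠ 0) (hd : (d : ℚ) = δ) (h0 : (δ : ZMod l) ≠ 0) :
    d ∈ c.localKernel ℚ_[l] := by
  by_cases hs : IsSquare (δ : ZMod l)
  · exact mem_localKernel_of_isSquare_zmod hl hd h0 hs
  by_cases hA : IsSquare (-(c.p * c.prodD) : ZMod l)
  swap
  · exact mem_localKernel_of_not_isSquare_neg_p hl hd hs hA
  have hA0 := neg_ne_zero.mpr (mul_ne_zero hp hD)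
  obtain ⟨k, hk0, hk, hk1⟩ := ZMod.exists_consecutive hl
  have hx := not_isSquare_mul_of_isSquare hk1 hA hA0
  refine mem_localKernel_of_not_isSquare hl hd hs hx ?_
  have := not_isSquare_mul_of_isSquare hx (hk.mul hA) (mul_ne_zero hk0 hA0)
  rw [mul_comm]
  convert this using 2
  rw [hq]; ring

/-- Every prime-to-`l` integer is locally trivial at an odd prime `l` not dividing `D`. -/
theorem mem_localKernel_of_not_dvd_prodD (hl : l ≠ 2) (hD : (c.prodD : ZMod l) ≠ 0)
    (hd : (d : ℚ) = δ) (h0 : (δ : ZMod l) ≠ 0) : d ∈ c.localKernel ℚ_[l] := by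
  have hlp : l.Prime := Fact.out
  have hpq : c.p ≠ c.q := by
    have := c.q_eq
    have := Nat.two_pow_pos c.m
    omega
  by_cases hp : (c.p : ZMod l) = 0
  · refine mem_localKernel_of_p hl hp ?_ hD hd h0
    rw [ZMod.natCast_eq_zero_iff, Nat.prime_dvd_prime_iff_eq hlp c.prime_p] at hp
    rw [Ne, ZMod.natCast_eq_zero_iff, Nat.prime_dvd_prime_iff_eq hlp c.prime_q]
    exact fun e => hpq (hp ▸ e)
  by_cases hq : (c.q : ZMod l) = 0
  · exact mem_localKernel_of_q hl hp hq hD hd h0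
  · exact mem_localKernel_of_good hl hp hq hD hd h0

/-- The local condition at `D j` in terms of Legendre symbols, for integers prime to `D j`. -/
theorem mem_localKernel_of_legendreSym (j : Fin n) (hd : (d : ℚ) = δ)
    (h0 : (δ : ZMod (c.D j)) ≠ 0)
    (h : (1 - legendreSym (c.D j) δ) * (1 - legendreSym (c.D j) ((c.p : ℤ) * c.q * δ)) = 0) :
    d ∈ c.localKernel ℚ_[c.D j] := by
  rcases mul_eq_zero.mp h with h | h
  · exact mem_localKernel_of_isSquare_zmod (c.D_ne_two j) hd h0
      ((legendreSym.eq_one_iff _ h0).mp (by linarith))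
  · have h1 : legendreSym (c.D j) ((c.p : ℤ) * c.q * δ) = 1 := by linarith
    have hne : (((c.p : ℤ) * c.q * δ : ℤ) : ZMod (c.D j)) ≠ 0 := by
      intro e
      rw [(legendreSym.eq_zero_iff _ _).mpr e] at h1
      exact zero_ne_one h1
    refine mem_localKernel_of_isSquare_pq ?_
    have := Padic.isSquare_intCast (c.D_ne_two j) hne ((legendreSym.eq_one_iff _ hne).mp h1)
    rw [mul_comm]
    simpa [hd] using this

theorem D_mul_hatD (i : Fin n) : c.D i * c.hatD i = c.prodD :=
  Finset.mul_prod_erase _ _ (Finset.mem_univ i)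

/-- Here `d` is not a unit, but `Dᵢ · (-r D) = Dᵢ² · (-r D̂ᵢ)` reduces the 2-torsion conditions for
`r = p, q` to Legendre symbols of units. -/
theorem mem_localKernel_D_self (i : Fin n) (hd : (d : ℚ) = c.D i)
    (h : (1 - legendreSym (c.D i) (-(c.q : ℤ) * c.hatD i)) *
      (1 - legendreSym (c.D i) (-(c.p : ℤ) * c.hatD i)) = 0) :
    d ∈ c.localKernel ℚ_[c.D i] := by
  have key : ∀ r : ℕ, 1 - legendreSym (c.D i) (-(r : ℤ) * c.hatD i) = 0 →
      IsSquare (((d : ℚ) : ℚ_[c.D i]) * -(r * c.prodD)) := by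
    intro r hr
    have h1 : legendreSym (c.D i) (-(r : ℤ) * c.hatD i) = 1 := by linarith
    have hne : ((-(r : ℤ) * c.hatD i : ℤ) : ZMod (c.D i)) ≠ 0 := by
      intro e
      rw [(legendreSym.eq_zero_iff _ _).mpr e] at h1
      exact zero_ne_one h1
    obtain ⟨a, ha⟩ := Padic.isSquare_intCast (c.D_ne_two i) hne
      ((legendreSym.eq_one_iff _ hne).mp h1)
    refine ⟨c.D i * a, ?_⟩
    rw [← c.D_mul_hatD i, hd]
    push_cast at ha ⊢
    linear_combination (c.D i : ℚ_[c.D i]) ^ 2 * ha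
  rcases mul_eq_zero.mp h with h | h
  · exact mem_localKernel_of_isSquare_neg_q (key _ h)
  · exact mem_localKernel_of_isSquare_neg_p (key _ h)

end OddPlaces

theorem mem_localKernel_real (d : ℚˣ) : d ∈ c.localKernel ℝ := by
  by_cases h : 0 ≤ ((d : ℚ) : ℝ)
  · exact mem_localKernel_of_isSquare (Real.isSquare_iff.mpr h)
  · refine mem_localKernel_of_isSquare_neg_p (Real.isSquare_iff.mpr ?_)
    have : (0 : ℝ) ≤ c.p * c.prodD := by positivity
    nlinarith

end FamilyData

namespace FamilyData

variable {n : ℕ} {c : FamilyData n}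

/-! ### The place `2`. -/

section PlaceTwo

theorem exists_odd_sq {a : ℤ} (h : Odd a) : ∃ e, a ^ 2 = 1 + 8 * e := by
  obtain ⟨e, he⟩ := Int.eight_dvd_sq_sub_one_of_odd h
  exact ⟨e, by linarith⟩

theorem isSquare_padic_two {a b e t : ℤ} (h : a = b ^ 2 * e) (he : e = 1 + 8 * t) :
    IsSquare (a : ℚ_[2]) := by
  have h1 : IsSquare (e : ℚ_[2]) :=
    Padic.isSquare_intCast_two (Int.modEq_iff_dvd.mpr ⟨-t, by rw [he]; ring⟩)
  rw [h]
  push_cast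
  exact (IsSquare.sq (b : ℚ_[2])).mul h1

theorem odd_p_int : Odd (c.p : ℤ) := (Int.odd_coe_nat _).mpr c.odd_p

theorem odd_D_int (i : Fin n) : Odd (c.D i : ℤ) :=
  (Int.odd_coe_nat _).mpr ((c.prime_D i).odd_of_ne_two (c.D_ne_two i))

theorem odd_prodD_int : Odd (c.prodD : ℤ) := by
  rw [Int.odd_coe_nat, prodD]
  exact Finset.prod_induction _ Odd (fun _ _ => Odd.mul) odd_one
    fun i _ => (c.prime_D i).odd_of_ne_two (c.D_ne_two i)

theorem q_cast_int : (c.q : ℤ) = c.p + 2 ^ c.m := by exact_mod_cast c.q_eq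

variable {d : ℚˣ} {δ k : ℤ}

theorem mem_localKernel_two_of_eq_one (hd : (d : ℚ) = δ) (h : δ = 1 + 8 * k) :
    d ∈ c.localKernel ℚ_[2] :=
  mem_localKernel_of_isSquare
    (by simpa [hd] using isSquare_padic_two (b := 1) (e := δ) (by ring) h)

theorem mem_localKernel_two_pq (hd : (d : ℚ) = δ) (h : δ * (c.p * c.q) = 1 + 8 * k) :
    d ∈ c.localKernel ℚ_[2] :=
  mem_localKernel_of_isSquare_pq
    (by simpa [hd] using isSquare_padic_two (a := δ * (c.p * c.q)) (b := 1) (by ring) h)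

theorem mem_localKernel_two_neg_p (hd : (d : ℚ) = δ) (h : δ * -(c.p * c.prodD) = 1 + 8 * k) :
    d ∈ c.localKernel ℚ_[2] :=
  mem_localKernel_of_isSquare_neg_p
    (by simpa [hd] using isSquare_padic_two (a := δ * -(c.p * c.prodD)) (b := 1) (by ring) h)

theorem mem_localKernel_two_neg_q (hd : (d : ℚ) = δ) (h : δ * -(c.q * c.prodD) = 1 + 8 * k) :
    d ∈ c.localKernel ℚ_[2] :=
  mem_localKernel_of_isSquare_neg_q
    (by simpa [hd] using isSquare_padic_two (a := δ * -(c.q * c.prodD)) (b := 1) (by ring) h)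

theorem mem_localKernel_two_of_point (hd : (d : ℚ) = δ) {x b e f t u : ℤ} (h1 : δ * x = 1 + 8 * t)
    (hA : x + c.p * c.prodD = b * e) (hB : x + c.q * c.prodD = b * f)
    (h2 : δ * (e * f) = 1 + 8 * u) : d ∈ c.localKernel ℚ_[2] :=
  mem_localKernel_intCast hd (x := x) (isSquare_padic_two (b := 1) (e := δ * x) (by ring) h1)
    (isSquare_padic_two (b := b) (e := δ * (e * f)) (by rw [hA, hB]; ring) h2)

theorem mem_localKernel_two_of_add_eq_eight_mul (hd : (d : ℚ) = δ) (hδ : Odd δ)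
    (h : δ + c.p * c.prodD = 8 * k) : d ∈ c.localKernel ℚ_[2] := by
  obtain ⟨e, he⟩ := exists_odd_sq hδ
  refine mem_localKernel_two_neg_p hd (k := e - δ * k) ?_
  linear_combination he - δ * h

/-- If `δ ≡ 5` modulo `8`, then `p q = p² + 4 p ≡ 5` gives `δ p q ≡ 1`. -/
theorem mem_localKernel_two_of_m_eq_two_of_eq_one (hm : c.m = 2) (hd : (d : ℚ) = δ)
    (h : δ = 1 + 4 * k) : d ∈ c.localKernel ℚ_[2] := by
  rcases Int.even_or_odd' k with ⟨j, rfl | rfl⟩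
  · exact mem_localKernel_two_of_eq_one hd (k := j) (by rw [h]; ring)
  · have hq := c.q_cast_int
    rw [hm] at hq
    obtain ⟨e, he⟩ := exists_odd_sq c.odd_p_int
    obtain ⟨a, ha⟩ := c.odd_p_int
    refine mem_localKernel_two_pq hd (k := δ * e + δ * a + 3 + 5 * j) ?_
    rw [hq]
    linear_combination δ * he + 4 * δ * ha + 5 * h

/-- If `δ + pD ≡ 4` modulo `8`, then `δ + qD = δ + pD + 4D ≡ 0`, so `-qD` replaces `-pD`. -/
theorem mem_localKernel_two_of_m_eq_two_of_add_eq (hm : c.m = 2) (hd : (d : ℚ) = δ)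
    (hδ : Odd δ) (h : δ + c.p * c.prodD = 4 * k) : d ∈ c.localKernel ℚ_[2] := by
  rcases Int.even_or_odd' k with ⟨j, rfl | rfl⟩
  · exact mem_localKernel_two_of_add_eq_eight_mul hd hδ (k := j) (by rw [h]; ring)
  · have hq := c.q_cast_int
    rw [hm] at hq
    obtain ⟨e, he⟩ := exists_odd_sq hδ
    obtain ⟨a, ha⟩ := c.odd_prodD_int
    refine mem_localKernel_two_neg_q hd (k := e - δ * (j + a + 1)) ?_
    rw [hq]
    linear_combination he - δ * h - 4 * δ * ha

theorem neg_one_mem_localKernel_two (hm : c.m = 2) (h : (c.p : ℤ) - c.prodD = 6 + 8 * k) :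
    (-1 : ℚˣ) ∈ c.localKernel ℚ_[2] := by
  have hq := c.q_cast_int
  rw [hm] at hq
  obtain ⟨e, he⟩ := exists_odd_sq c.odd_prodD_int
  set D := (c.prodD : ℤ)
  -- At `x = -1` both factors are twice an odd number, and the product of the odd parts is `≡ 15 D²
  -- ≡ -1` modulo `8`.
  refine mem_localKernel_two_of_point (δ := -1) (x := -1) (b := 2) (t := 0)
    (e := 4 * e + 3 * D + 4 * k * D) (f := 4 * e + 5 * D + 4 * k * D)
    (u := -2 - 15 * e - 4 * (e + k * D) * D - 2 * (e + k * D) ^ 2) (by simp) (by ring) ?_ ?_ ?_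
  · linear_combination D * h + he
  · rw [hq]
    linear_combination D * h + he
  · linear_combination -15 * he

theorem mem_localKernel_two_of_m_eq_three (hm : c.m = 3) (hd : (d : ℚ) = δ) {s : ℤ}
    (hs : δ = 3 + 4 * s) (h : δ + c.p * c.prodD = 4 + 8 * k) : d ∈ c.localKernel ℚ_[2] := by
  have hq := c.q_cast_int
  rw [hm] at hq
  obtain ⟨e, he⟩ := exists_odd_sq c.odd_prodD_int
  obtain ⟨a, ha⟩ := c.odd_prodD_int
  set D := (c.prodD : ℤ)
  -- `(3 + 4s)(1 + 2s)(3 + 2s) - 1` is `4 s (s + 1)` modulo `8`, so the parity of `s (s + 1)`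
  -- finishes the congruence.
  obtain ⟨v, hv⟩ := (Int.even_mul_succ_self s).two_dvd
  have hδ : Odd δ := ⟨2 * s + 1, by rw [hs]; ring⟩
  obtain ⟨g, hg⟩ := exists_odd_sq hδ
  -- `x + p D = 4 D (1 + 2 s)` and `x ≡ δ` modulo `8`
  refine mem_localKernel_two_of_point hd (x := 4 * D * (1 + 2 * s) - c.p * D) (b := 4)
    (e := D * (1 + 2 * s)) (f := D * (1 + 2 * s) + 2 * D)
    (t := g + δ * (a + D * s - k)) (u := e * δ * (1 + 2 * s) * (3 + 2 * s) + 1 + 2 * s ^ 3 + 5 * s ^ 2 + 4 * s + v)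
    ?_ (by ring) ?_ ?_
  · linear_combination 4 * δ * ha - δ * h + hg
  · rw [hq]; ring
  · subst hs
    linear_combination (3 + 4 * s) * (1 + 2 * s) * (3 + 2 * s) * he + 4 * hv

/-- Modulo `8`, `a² + 4 a b ≡ 5`. This serves points at which `x + pD` and `x + qD`, once a common
power of `2` is removed, are odd and differ by `4D`. -/
theorem exists_mul_eq {a b : ℤ} (hδ : δ = 5 + 8 * k) (ha : Odd a) (hb : Odd b) :
    ∃ u, δ * (a * (a + 4 * b)) = 1 + 8 * u := by
  obtain ⟨e, he⟩ := exists_odd_sq ha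
  obtain ⟨f, hf⟩ := ha.mul hb
  refine ⟨3 + 5 * e + 5 * f + k * (a * (a + 4 * b)), ?_⟩
  rw [hδ]
  linear_combination 5 * he + 20 * hf

theorem mem_localKernel_two_of_m_eq_three_of_eq_five (hm : c.m = 3) (hd : (d : ℚ) = δ) {s : ℤ}
    (hs : δ = 5 + 8 * s) (h : c.p * c.prodD - δ = 4 * k) : d ∈ c.localKernel ℚ_[2] := by
  have hq := c.q_cast_int
  rw [hm] at hq
  have hδ : Odd δ := ⟨2 + 4 * s, by rw [hs]; ring⟩
  obtain ⟨g, hg⟩ := exists_odd_sq hδ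
  have hodd : Odd (δ + 2 * k) := hδ.add_even (even_two_mul k)
  obtain ⟨u, hu⟩ := exists_mul_eq hs hodd c.odd_prodD_int
  refine mem_localKernel_two_of_point hd (x := δ) (b := 2) (t := g) (by rw [← hg]; ring) ?_ ?_ hu
  · linear_combination h
  · rw [hq]
    linear_combination h

theorem mem_localKernel_two_of_m_eq_four (hm : c.m = 4) (hd : (d : ℚ) = δ) {s : ℤ}
    (hs : δ = 5 + 8 * s) (h : c.p * c.prodD + δ = 4 + 8 * k) : d ∈ c.localKernel ℚ_[2] := by
  have hq := c.q_cast_int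
  rw [hm] at hq
  have hδ : Odd δ := ⟨2 + 4 * s, by rw [hs]; ring⟩
  obtain ⟨g, hg⟩ := exists_odd_sq hδ
  have hodd : Odd (1 + 2 * k) := odd_one.add_even (even_two_mul k)
  obtain ⟨u, hu⟩ := exists_mul_eq hs hodd c.odd_prodD_int
  refine mem_localKernel_two_of_point hd (x := δ) (b := 4) (t := g) (by rw [← hg]; ring) ?_ ?_ hu
  · linear_combination h
  · rw [hq]
    linear_combination h

theorem exists_eq_of_modEq {a b N : ℤ} (h : a ≡ b [ZMOD N]) : ∃ k, a = b + N * k := by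
  obtain ⟨k, hk⟩ := h.symm.dvd
  exact ⟨k, by linarith⟩

theorem neg_one_mem_localKernel_two_of_deltaCond (h : c.DeltaCond) :
    (-1 : ℚˣ) ∈ c.localKernel ℚ_[2] := by
  have hd : ((-1 : ℚˣ) : ℚ) = ((-1 : ℤ) : ℚ) := by simp
  obtain ⟨e, he⟩ := exists_odd_sq c.odd_prodD_int
  rcases h with ⟨hm, h⟩ | ⟨hm, h⟩ | ⟨hm, h⟩
  · obtain ⟨a, ha⟩ := c.odd_p_int
    obtain ⟨b, hb⟩ := c.odd_prodD_int
    -- `p - D` is even, so excluding `2` modulo `8` leaves these cases.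
    have h' : (c.p : ℤ) - c.prodD ≡ 6 [ZMOD 8] ∨ (c.p : ℤ) - c.prodD ≡ 0 [ZMOD 4] := by
      unfold Int.ModEq at *
      omega
    rcases h' with h' | h' <;> obtain ⟨k, hk⟩ := exists_eq_of_modEq h'
    · exact neg_one_mem_localKernel_two hm hk
    · refine mem_localKernel_two_of_m_eq_two_of_add_eq hm hd (by decide)
        (k := k * c.prodD + 2 * e) ?_
      linear_combination (c.prodD : ℤ) * hk + he
  · obtain ⟨k, hk⟩ := exists_eq_of_modEq h
    rcases Int.even_or_odd' (k * c.prodD) with ⟨j, hj | hj⟩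
    · refine mem_localKernel_two_of_add_eq_eight_mul hd (by decide) (k := j + e) ?_
      linear_combination (c.prodD : ℤ) * hk + he + 4 * hj
    · refine mem_localKernel_two_of_m_eq_three hm hd (s := -1) (k := j + e) (by norm_num) ?_
      linear_combination (c.prodD : ℤ) * hk + he + 4 * hj
  · obtain ⟨k, hk⟩ := exists_eq_of_modEq h
    refine mem_localKernel_two_of_add_eq_eight_mul hd (by decide) (k := k * c.prodD + e) ?_
    linear_combination (c.prodD : ℤ) * hk + he

theorem D_mem_localKernel_two_of_inI {i : Fin n} (hd : (d : ℚ) = c.D i) (h : c.InI i) :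
    d ∈ c.localKernel ℚ_[2] := by
  have hd : (d : ℚ) = ((c.D i : ℤ) : ℚ) := by simp [hd]
  have hodd := c.odd_D_int i
  have h1 : (c.D i : ℤ) ≡ 1 [ZMOD 8] → d ∈ c.localKernel ℚ_[2] := fun h => by
    obtain ⟨k, hk⟩ := exists_eq_of_modEq h
    exact mem_localKernel_two_of_eq_one hd hk
  have h2 : (c.D i : ℤ) + c.p * c.prodD ≡ 0 [ZMOD 8] → d ∈ c.localKernel ℚ_[2] := fun h => by
    obtain ⟨k, hk⟩ := exists_eq_of_modEq h
    exact mem_localKernel_two_of_add_eq_eight_mul hd hodd (hk.trans (zero_add _))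
  rcases h with ⟨hm, h | h | ⟨h, h'⟩⟩ | ⟨hm, h | h | ⟨h, h'⟩ | ⟨h, h'⟩⟩ |
    ⟨hm, h | h | ⟨h, h'⟩⟩ | ⟨hm, h | h⟩
  · obtain ⟨k, hk⟩ := exists_eq_of_modEq h
    exact mem_localKernel_two_of_m_eq_two_of_eq_one hm hd hk
  · obtain ⟨k, hk⟩ := exists_eq_of_modEq h
    exact mem_localKernel_two_of_m_eq_two_of_add_eq hm hd hodd (hk.trans (zero_add _))
  · obtain ⟨k, hk⟩ := exists_eq_of_modEq h
    obtain ⟨k', hk'⟩ := exists_eq_of_modEq h'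
    -- Both `-1` and `-Dᵢ ≡ 1` modulo `4` are locally trivial, hence so is their product.
    have hneg : -d ∈ c.localKernel ℚ_[2] :=
      mem_localKernel_two_of_m_eq_two_of_eq_one hm (δ := -(c.D i : ℤ)) (k := -1 - k)
        (by simp [hd]) (by rw [hk]; ring)
    simpa using mul_mem (neg_one_mem_localKernel_two hm hk') hneg
  · exact h1 h
  · exact h2 h
  · obtain ⟨k, hk⟩ := exists_eq_of_modEq h
    obtain ⟨k', hk'⟩ := exists_eq_of_modEq h'
    exact mem_localKernel_two_of_m_eq_three hm hd hk ((add_comm _ _).trans hk')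
  · obtain ⟨k, hk⟩ := exists_eq_of_modEq h
    obtain ⟨k', hk'⟩ := exists_eq_of_modEq h'
    exact mem_localKernel_two_of_m_eq_three_of_eq_five hm hd hk (hk'.trans (zero_add _))
  · exact h1 h
  · exact h2 h
  · obtain ⟨k, hk⟩ := exists_eq_of_modEq h
    obtain ⟨k', hk'⟩ := exists_eq_of_modEq h'
    exact mem_localKernel_two_of_m_eq_four hm hd hk hk'
  · exact h1 h
  · exact h2 h

end PlaceTwo
end FamilyData

namespace FamilyData

variable {n : ℕ} {c : FamilyData n}

/-! ### From vanishing of `Π⁺` to Selmer classes. -/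

section SelmerMembership

theorem mk_mem_selmerInSquareClasses {d : ℚˣ}
    (h : ∀ (l : ℕ) [Fact l.Prime], d ∈ c.localKernel ℚ_[l]) :
    (QuotientGroup.mk d : ℚˣ ⧸ squares) ∈ c.selmerInSquareClasses := by
  refine ⟨⟨c.kummerFun d, c.kummerFun_mem d⟩, ⟨mem_localKernel_real d, ?_⟩, rfl⟩
  refine AddSubgroup.mem_iInf.mpr fun ℓ => ?_
  have : Fact (ℓ : ℕ).Prime := ⟨ℓ.2⟩
  exact h ℓ

theorem legendreSym_le_one (l : ℕ) [Fact l.Prime] (a : ℤ) : legendreSym l a ≤ 1 := by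
  by_cases h : (a : ZMod l) = 0
  · simp [(legendreSym.eq_zero_iff l a).mpr h]
  · rcases legendreSym.eq_one_or_neg_one l h with h | h <;> simp [h]

theorem one_sub_legendreSym_mul_nonneg (l : ℕ) [Fact l.Prime] (a b : ℤ) :
    0 ≤ (1 - legendreSym l a) * (1 - legendreSym l b) :=
  mul_nonneg (sub_nonneg.mpr (legendreSym_le_one l a)) (sub_nonneg.mpr (legendreSym_le_one l b))

theorem piTerm_nonneg (i : Fin n) : 0 ≤ c.PiTerm i :=
  add_nonneg (one_sub_legendreSym_mul_nonneg _ _ _)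
    (Finset.sum_nonneg fun _ _ => one_sub_legendreSym_mul_nonneg _ _ _)

theorem delta_nonneg : 0 ≤ c.delta := by
  unfold delta
  split_ifs <;> norm_num

theorem piLast_nonneg : 0 ≤ c.PiLast :=
  add_nonneg delta_nonneg (Finset.sum_nonneg fun _ _ => one_sub_legendreSym_mul_nonneg _ _ _)

theorem exists_eq_D_of_dvd_prodD {l : ℕ} (hl : l.Prime) (h : (c.prodD : ZMod l) = 0) :
    ∃ j, l = c.D j := by
  rw [ZMod.natCast_eq_zero_iff, prodD, hl.prime.dvd_finsetProd_iff] at h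
  obtain ⟨j, -, hj⟩ := h
  exact ⟨j, (Nat.prime_dvd_prime_iff_eq hl (c.prime_D j)).mp hj⟩

/-- Each hypothesis serves its own places: `InI` the prime `2`, the first product in `PiTerm` the
prime `Dᵢ`, the summand of index `j` the prime `Dⱼ`. The other places impose nothing. -/
theorem D_mem_selmer {i : Fin n} (hI : c.InI i) (hPi : c.PiTerm i = 0) {d : ℚˣ}
    (hd : (d : ℚ) = c.D i) :
    (QuotientGroup.mk d : ℚˣ ⧸ squares) ∈ c.selmerInSquareClasses := by
  have hd' : (d : ℚ) = ((c.D i : ℤ) : ℚ) := by simp [hd]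
  obtain ⟨h1, h2⟩ := (add_eq_zero_iff_of_nonneg (one_sub_legendreSym_mul_nonneg _ _ _)
    (Finset.sum_nonneg fun _ _ => one_sub_legendreSym_mul_nonneg _ _ _)).mp hPi
  rw [Finset.sum_eq_zero_iff_of_nonneg fun _ _ => one_sub_legendreSym_mul_nonneg _ _ _] at h2
  refine mk_mem_selmerInSquareClasses fun l hl => ?_
  rcases eq_or_ne l 2 with rfl | hl2
  · exact D_mem_localKernel_two_of_inI hd hI
  by_cases hD : (c.prodD : ZMod l) = 0
  · obtain ⟨j, rfl⟩ := exists_eq_D_of_dvd_prodD hl.out hD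
    rcases eq_or_ne j i with rfl | hji
    · exact mem_localKernel_D_self j hd h1
    · refine mem_localKernel_of_legendreSym j hd' ?_
        (h2 j (Finset.mem_erase.mpr ⟨hji, Finset.mem_univ j⟩))
      rw [Int.cast_natCast, Ne, ZMod.natCast_eq_zero_iff,
        Nat.prime_dvd_prime_iff_eq (c.prime_D j) (c.prime_D i)]
      exact fun e => hji (c.D_injective e)
  · refine mem_localKernel_of_not_dvd_prodD hl2 hD hd' ?_
    intro e
    rw [← c.D_mul_hatD i] at hD
    push_cast at hD e
    exact hD (by rw [e, zero_mul])

theorem neg_one_mem_selmer (hPi : c.PiLast = 0) :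
    (QuotientGroup.mk (-1) : ℚˣ ⧸ squares) ∈ c.selmerInSquareClasses := by
  have hd : ((-1 : ℚˣ) : ℚ) = ((-1 : ℤ) : ℚ) := by simp
  obtain ⟨h1, h2⟩ := (add_eq_zero_iff_of_nonneg delta_nonneg
    (Finset.sum_nonneg fun _ _ => one_sub_legendreSym_mul_nonneg _ _ _)).mp hPi
  rw [Finset.sum_eq_zero_iff_of_nonneg fun _ _ => one_sub_legendreSym_mul_nonneg _ _ _] at h2
  refine mk_mem_selmerInSquareClasses fun l hl => ?_
  have h0 : ((-1 : ℤ) : ZMod l) ≠ 0 := by simp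
  rcases eq_or_ne l 2 with rfl | hl2
  · refine neg_one_mem_localKernel_two_of_deltaCond ?_
    by_contra h
    simp [delta, h] at h1
  by_cases hD : (c.prodD : ZMod l) = 0
  · obtain ⟨j, rfl⟩ := exists_eq_D_of_dvd_prodD hl.out hD
    refine mem_localKernel_of_legendreSym j hd h0 ?_
    rw [mul_neg_one]
    exact h2 j (Finset.mem_univ j)
  · exact mem_localKernel_of_not_dvd_prodD hl2 hD hd h0

end SelmerMembership

/-! ### Independence modulo squares. -/

section Independence

/-- The generators `-1, D₁, …, Dₙ`. -/
def gen (c : FamilyData n) : Option (Fin n) → ℚˣ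
  | none => -1
  | some i => Units.mk0 (c.D i) (by exact_mod_cast (c.prime_D i).ne_zero)

/-- The sign of a rational number, as an element of `ZMod 2`. -/
def signHom : ℚˣ →* Multiplicative (ZMod 2) where
  toFun d := Multiplicative.ofAdd (if (d : ℚ) < 0 then 1 else 0)
  map_one' := by simp
  map_mul' d e := by
    rw [← ofAdd_add]
    congr 1
    rcases lt_or_gt_of_ne d.ne_zero with hd | hd <;> rcases lt_or_gt_of_ne e.ne_zero with he | he
    · rw [if_neg (by push_cast; exact (mul_pos_of_neg_of_neg hd he).not_gt), if_pos hd, if_pos he]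
      rfl
    · rw [if_pos (by push_cast; exact mul_neg_of_neg_of_pos hd he), if_pos hd, if_neg he.not_gt]
      rfl
    · rw [if_pos (by push_cast; exact mul_neg_of_pos_of_neg hd he), if_neg hd.not_gt, if_pos he]
      rfl
    · rw [if_neg (by push_cast; exact (mul_pos hd he).not_gt), if_neg hd.not_gt, if_neg he.not_gt]
      rfl

/-- The parity of the `l`-adic valuation of a rational number. -/
def valHom (l : ℕ) [Fact l.Prime] : ℚˣ →* Multiplicative (ZMod 2) where
  toFun d := Multiplicative.ofAdd (padicValRat l d : ZMod 2)
  map_one' := by simp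
  map_mul' d e := by
    rw [Units.val_mul, padicValRat.mul d.ne_zero e.ne_zero, Int.cast_add, ofAdd_add]

/-- The functionals on `ℚˣ` dual to the generators `-1, D₁, …, Dₙ`. -/
def dualHom (c : FamilyData n) : Option (Fin n) → ℚˣ →* Multiplicative (ZMod 2)
  | none => signHom
  | some i => valHom (c.D i)

theorem dualHom_gen (o o' : Option (Fin n)) :
    Multiplicative.toAdd (c.dualHom o (c.gen o')) = (Pi.single o' (1 : ZMod 2) : _ → ZMod 2) o := by
  rcases o with _ | i <;> rcases o' with _ | j
  · simp [dualHom, gen, signHom]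
  · have : ¬ ((c.D j : ℕ) : ℚ) < 0 := (Nat.cast_nonneg _).not_gt
    simp [dualHom, gen, signHom, this]
  · simp [dualHom, gen, valHom, padicValRat.neg]
  · rcases eq_or_ne i j with rfl | h
    · have : padicValRat (c.D i) ((c.D i : ℕ) : ℚ) = 1 :=
        padicValRat.self (c.prime_D i).one_lt
      simp [dualHom, gen, valHom, this]
    · have : padicValNat (c.D i) (c.D j) = 0 :=
        padicValNat_primes fun e => h (c.D_injective e)
      have h' : some i ≠ some j := fun e => h (Option.some_injective _ e)
      simp [dualHom, gen, valHom, this, h']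

theorem squareClass_mul_self (x : ℚˣ ⧸ squares) : x * x = 1 := by
  induction x using QuotientGroup.induction_on with
  | H d =>
    rw [← QuotientGroup.mk_mul, QuotientGroup.eq_one_iff]
    exact ⟨d, pow_two d⟩

noncomputable instance moduleSquareClasses : Module (ZMod 2) (Additive (ℚˣ ⧸ squares)) :=
  AddCommGroup.zmodModule fun x => by
    rw [two_nsmul]
    exact squareClass_mul_self (Additive.toMul x)

/-- The functionals of `dualHom`, on square classes. -/
noncomputable def dualMap (c : FamilyData n) :
    Additive (ℚˣ ⧸ squares) →+ (Option (Fin n) → ZMod 2) :=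
  AddMonoidHom.pi fun o => MonoidHom.toAdditiveLeft (QuotientGroup.lift squares (c.dualHom o) (by
    rintro _ ⟨d, rfl⟩
    rw [MonoidHom.mem_ker, powMonoidHom_apply, map_pow]
    exact CharTwo.add_self_eq_zero (Multiplicative.toAdd (c.dualHom o d)) ▸
      pow_two (c.dualHom o d)))

/-- The square classes of the generators `-1, D₁, …, Dₙ`. -/
noncomputable def genClass (c : FamilyData n) (o : Option (Fin n)) : Additive (ℚˣ ⧸ squares) :=
  Additive.ofMul (QuotientGroup.mk (c.gen o))

/-- The sign and the parities of the `Dᵢ`-adic valuations send the generators to the standard basis.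
-/
theorem linearIndependent_genClass : LinearIndependent (ZMod 2) c.genClass := by
  refine LinearIndependent.of_comp (c.dualMap.toZModLinearMap 2) ?_
  have h : c.dualMap.toZModLinearMap 2 ∘ c.genClass = fun o => Pi.single o (1 : ZMod 2) := by
    ext o o'
    exact dualHom_gen o' o
  rw [h]
  exact Pi.linearIndependent_single_one (Option (Fin n)) (ZMod 2)

/-- Over `ZMod 2` a subgroup is already a subspace, so the generated subgroup is the linear span,
and a basis supplies coordinates. -/
theorem closure_equiv {G : Type*} [CommGroup G] [Module (ZMod 2) (Additive G)] {ι : Type*}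
    [Finite ι] {v : ι → G} (hv : LinearIndependent (ZMod 2) fun i => Additive.ofMul (v i)) :
    Nonempty (Subgroup.closure (Set.range v) ≃* Multiplicative (ι → ZMod 2)) := by
  let S := Submodule.span (ZMod 2) (Set.range fun i => Additive.ofMul (v i))
  have key : ∀ x : G, x ∈ Subgroup.closure (Set.range v) ↔ Additive.ofMul x ∈ S := by
    intro x
    constructor
    · intro h
      induction h using Subgroup.closure_induction with
      | mem x hx =>
        obtain ⟨i, rfl⟩ := hx
        exact Submodule.subset_span ⟨i, rfl⟩
      | one => exact S.zero_mem
      | mul x y _ _ hx hy => exact S.add_mem hx hy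
      | inv x _ hx => exact S.neg_mem hx
    · intro h
      have hle : S ≤ AddSubgroup.toZModSubmodule 2
          (Subgroup.closure (Set.range v)).toAddSubgroup := by
        rw [Submodule.span_le]
        rintro _ ⟨i, rfl⟩
        exact (Subgroup.subset_closure ⟨i, rfl⟩ : v i ∈ Subgroup.closure (Set.range v))
      exact hle h
  let e := hv.linearCombinationEquiv.symm.trans (Finsupp.linearEquivFunOnFinite (ZMod 2) (ZMod 2) ι)
  exact ⟨{
    toFun x := Multiplicative.ofAdd (e ⟨Additive.ofMul x.1, (key x.1).mp x.2⟩)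
    invFun y := ⟨Additive.toMul (e.symm (Multiplicative.toAdd y)).1, (key _).mpr (e.symm _).2⟩
    left_inv x := Subtype.ext (by simp)
    right_inv y := by simp
    map_mul' x y := by
      rw [← ofAdd_add, ← map_add]
      rfl }⟩

end Independence

/-! ### Counting the selected generators. -/

section Count

open Classical in
/-- The generators counted by `ρ⁺(D')`. -/
noncomputable def selectedIndices (c : FamilyData n) : Finset (Option (Fin n)) :=
  Finset.univ.filter fun o => o.elim (c.PiLast = 0) fun i => c.InI i ∧ c.PiTerm i = 0

theorem floor_one_div_one_add {a : ℤ} (ha : 0 ≤ a) :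
    ⌊(1 : ℚ) / (1 + (a : ℚ))⌋₊ = if a = 0 then 1 else 0 := by
  split_ifs with h
  · simp [h]
  · rw [Nat.floor_eq_zero, div_lt_one (by positivity)]
    have : (0 : ℚ) < a := by exact_mod_cast lt_of_le_of_ne ha (Ne.symm h)
    linarith

theorem card_selectedIndices : c.selectedIndices.card = c.rho := by
  classical
  rw [selectedIndices, Finset.card_filter, Fintype.sum_option, rho, setI, Finset.sum_filter,
    floor_one_div_one_add piLast_nonneg, add_comm]
  congr 1
  · refine Finset.sum_congr rfl fun i _ => ?_
    rw [floor_one_div_one_add (piTerm_nonneg i)]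
    by_cases h1 : c.InI i <;> by_cases h2 : c.PiTerm i = 0 <;> simp [h1, h2]
  · by_cases h : c.PiLast = 0 <;> simp [h]

theorem genClass_mem_selmer {o : Option (Fin n)} (ho : o ∈ c.selectedIndices) :
    (QuotientGroup.mk (c.gen o) : ℚˣ ⧸ squares) ∈ c.selmerInSquareClasses := by
  classical
  rw [selectedIndices, Finset.mem_filter] at ho
  rcases o with _ | i
  · exact neg_one_mem_selmer ho.2
  · exact D_mem_selmer ho.2.1 ho.2.2 rfl

theorem gen_injective : Function.Injective c.gen := fun _ _ h =>
  linearIndependent_genClass.injective (congrArg (fun d => Additive.ofMul (QuotientGroup.mk d)) h)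

theorem linearIndependent_kummer :
    LinearIndependent (ZMod 2) fun o => (c.kummer (QuotientGroup.mk (c.gen o))).toAdd :=
  linearIndependent_genClass.map' ((MonoidHom.toAdditiveLeft c.kummer).toZModLinearMap 2)
    (LinearMap.ker_eq_bot.mpr c.kummer_injective)

theorem rho_le_rank :
    (c.rho : Cardinal) ≤ Module.rank (ZMod 2) (AddSubgroup.toZModSubmodule 2 c.selmer) := by
  let w : c.selectedIndices → AddSubgroup.toZModSubmodule 2 c.selmer := fun o =>
    ⟨(c.kummer (QuotientGroup.mk (c.gen o))).toAdd, genClass_mem_selmer o.2⟩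
  have hw : LinearIndependent (ZMod 2) w :=
    LinearIndependent.of_comp (AddSubgroup.toZModSubmodule 2 c.selmer).subtype
      (linearIndependent_kummer.comp _ Subtype.val_injective)
  have := hw.cardinal_le_rank
  rwa [Cardinal.mk_coe_finset, card_selectedIndices] at this

end Count
end FamilyData

/-! ### The main theorem. -/

theorem theoremA2 {n : ℕ} (c : FamilyData n) (hm : 2 ≤ c.m) :
    (∃ T : Finset ℚˣ,
      (∀ t ∈ T, (t : ℚ) = -1 ∨ ∃ i, (t : ℚ) = c.D i) ∧
      T.card = c.rho ∧
      Subgroup.closure ((QuotientGroup.mk : ℚˣ → ℚˣ ⧸ FamilyData.squares) '' (T : Set ℚˣ)) ≤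
        c.selmerInSquareClasses ∧
      Nonempty
        (Subgroup.closure ((QuotientGroup.mk : ℚˣ → ℚˣ ⧸ FamilyData.squares) '' (T : Set ℚˣ)) ≃*
          Multiplicative (Fin c.rho → ZMod 2))) ∧
    (c.rho : Cardinal) ≤ Module.rank (ZMod 2) (AddSubgroup.toZModSubmodule 2 c.selmer) := by
  refine ⟨⟨c.selectedIndices.map ⟨c.gen, FamilyData.gen_injective⟩, ?_, ?_, ?_, ?_⟩,
    FamilyData.rho_le_rank⟩
  · intro t ht
    obtain ⟨o, -, rfl⟩ := Finset.mem_map.mp ht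
    rcases o with _ | i
    · exact Or.inl (by simp [FamilyData.gen])
    · exact Or.inr ⟨i, rfl⟩
  · rw [Finset.card_map, FamilyData.card_selectedIndices]
  · rw [Subgroup.closure_le]
    rintro _ ⟨t, ht, rfl⟩
    obtain ⟨o, ho, rfl⟩ := Finset.mem_map.mp ht
    exact FamilyData.genClass_mem_selmer ho
  · let e : Fin c.rho ≃ c.selectedIndices :=
      (Finset.equivFinOfCardEq FamilyData.card_selectedIndices).symm
    let v : Fin c.rho → ℚˣ ⧸ FamilyData.squares := fun k => QuotientGroup.mk (c.gen (e k))
    have hv : LinearIndependent (ZMod 2) fun k => Additive.ofMul (v k) :=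
      FamilyData.linearIndependent_genClass.comp (fun k => (e k : Option (Fin n)))
        (Subtype.val_injective.comp e.injective)
    have hrange : (QuotientGroup.mk : ℚˣ → ℚˣ ⧸ FamilyData.squares) ''
        ((c.selectedIndices.map ⟨c.gen, FamilyData.gen_injective⟩ : Finset ℚˣ) : Set ℚˣ) =
          Set.range v := by
      have : v = (fun o : c.selectedIndices => QuotientGroup.mk (c.gen o)) ∘ e := rfl
      rw [this, EquivLike.range_comp]
      ext x
      simp
    rw [hrange]
    exact FamilyData.closure_equiv hv
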